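/- Theorem (universal $R$-matrix of $\widehat U^{(vN-Hopf)}_{K+L}$). Let $n\ge 3$ be an odd integer and let $q\in\mathbb C$ be a primitive $n$-th root of unity. Let $U=U^{(vN-Hopf)}_{K,L}$ be the unital associative $\mathbb C$-algebra generated by $K,\overline K,L,\overline L,E,F$ with relations $$K\overline KK=K,\quad \overline KK\overline K=\overline K,\quad K\overline K=\overline KK,\quad L\overline LL=L,\quad \overline LL\overline L=\overline L,\quad L\overline L=\overline LL,\quad K\overline K+L\overline L=\mathbf 1,$$ $$KE=q^2EK,\quad LE=q^2EL,\quad \overline KE=q^{-2}E\overline K,\quad \overline LE=q^{-2}E\overline L,$$ $$KF=q^{-2}FK,\quad LF=q^{-2}FL,\quad \overline KF=q^{2}F\overline K,\quad \overline LF=q^{2}F\overline L,\quad EF-FE=\frac{(K+L)-(\overline K+\overline L)}{q-q^{-1}},$$ with the bialgebra structure given by $$\Delta(K)=K\otimes K,\quad \Delta(L)=L\otimes L+L\otimes K+K\otimes L,\quad \Delta(\overline K)=\overline K\otimes\overline K,\quad \Delta(\overline L)=\overline L\otimes\overline L+\overline L\otimes\overline K+\overline K\otimes\overline L,$$ $$\Delta(E)=\mathbf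 1\otimes E+E\otimes(K+L),\quad \Delta(F)=F\otimes\mathbf 1+(\overline K+\overline L)\otimes F,$$ $$\varepsilon(K)=\varepsilon(\overline K)=1,\quad \varepsilon(L)=\varepsilon(\overline L)=\varepsilon(E)=\varepsilon(F)=0,$$ and with the antimorphism of algebras $\mathsf T$ given by $\mathsf T(K)=\overline K$, $\mathsf T(\overline K)=K$, $\mathsf T(L)=\overline L$, $\mathsf T(\overline L)=L$, $\mathsf T(E)=-E(\overline K+\overline L)$, $\mathsf T(F)=-(K+L)F$. Let $I$ be the two-sided ideal of $U$ generated by $K^n+L^n-\mathbf 1$, $E^n$, $F^n$, and let $\widehat U=U/I$. Then $I$ is also a coideal, so that $\widehat U$ is a bialgebra, and $\mathsf T$ induces on $\widehat U$ a von Neumann regular antipode, i.e. an antimorphism of algebras $\widehat{\mathsf T}$ with $\mathsf{id}\star\widehat{\mathsf T}\star\mathsf{id}=\mathsf{id}$ and $\widehat{\mathsf T}\star\mathsf{id}\star\widehat{\mathsf T}=\widehat{\mathsf T}$, where $\star$ is the convolution $f\star g=\mu(f\otimes g)\Delta$ (thus $\widehat U$ is a von Neumann–Hopf algebra). Moreover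 the element $$\widehat R=\sum_{0\le i,j,m\le n-1}A_m^{ij}(q)\,E^m(K^i+L^i)\otimes F^m(K^j+L^j)\in\widehat U\otimes\widehat U,$$ where $$A_m^{ij}(q)=\frac1n\,\frac{(q-q^{-1})^m}{[m]!}\,q^{\frac{m(m-1)}2+2m(i-j)-2ij},\qquad [m]!=[1][2]\cdots[m],\qquad [m]=\frac{q^m-q^{-m}}{q-q^{-1}},$$ and where $K^0:=K\overline K$ and $L^0:=L\overline L$ (so that $K^0+L^0=\mathbf 1$), is a universal $R$-matrix of $\widehat U$: it is invertible, $\Delta^{cop}(b)=\widehat R\,\Delta(b)\,\widehat R^{-1}$ for all $b\in\widehat U$, where $\Delta^{cop}$ is the opposite comultiplication, and $$(\Delta\otimes\mathsf{id})(\widehat R)=\widehat R_{13}\widehat R_{23},\qquad(\mathsf{id}\otimes\Delta)(\widehat R)=\widehat R_{13}\widehat R_{12}.$$ -/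

import Mathlib

open scoped TensorProduct

noncomputable section

/-! ### The bialgebra `U_{K,L}` with central idempotents `P = K K̄` and `Q = L L̄` -/

namespace VNHopf

/-- The six generators `K, K̄, L, L̄, E, F`. -/
inductive Gen
  | K | Kbar | L | Lbar | E | F

namespace Free

/-- The generator `g`, seen in the free unital associative algebra. -/
abbrev gen (g : Gen) : FreeAlgebra ℂ Gen := FreeAlgebra.ι ℂ g

end Free

open Free Gen in
/-- The defining relations. -/
inductive Rel (q : ℂ) : FreeAlgebra ℂ Gen → FreeAlgebra ℂ Gen → Prop
  | K_Kbar_K : Rel q (gen K * gen Kbar * gen K) (gen K)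
  | Kbar_K_Kbar : Rel q (gen Kbar * gen K * gen Kbar) (gen Kbar)
  | K_comm : Rel q (gen K * gen Kbar) (gen Kbar * gen K)
  | L_Lbar_L : Rel q (gen L * gen Lbar * gen L) (gen L)
  | Lbar_L_Lbar : Rel q (gen Lbar * gen L * gen Lbar) (gen Lbar)
  | L_comm : Rel q (gen L * gen Lbar) (gen Lbar * gen L)
  | unity : Rel q (gen K * gen Kbar + gen L * gen Lbar) 1
  | K_E : Rel q (gen K * gen E) (q ^ 2 • (gen E * gen K))
  | L_E : Rel q (gen L * gen E) (q ^ 2 • (gen E * gen L))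
  | Kbar_E : Rel q (gen Kbar * gen E) ((q ^ 2)⁻¹ • (gen E * gen Kbar))
  | Lbar_E : Rel q (gen Lbar * gen E) ((q ^ 2)⁻¹ • (gen E * gen Lbar))
  | K_F : Rel q (gen K * gen F) ((q ^ 2)⁻¹ • (gen F * gen K))
  | L_F : Rel q (gen L * gen F) ((q ^ 2)⁻¹ • (gen F * gen L))
  | Kbar_F : Rel q (gen Kbar * gen F) (q ^ 2 • (gen F * gen Kbar))
  | Lbar_F : Rel q (gen Lbar * gen F) (q ^ 2 • (gen F * gen Lbar))
  | E_F : Rel q (gen E * gen F - gen F * gen E)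
      ((q - q⁻¹)⁻¹ • ((gen K + gen L) - (gen Kbar + gen Lbar)))

/-- The unital associative `ℂ`-algebra on the generators `K, K̄, L, L̄, E, F` subject to the
relations `Rel q`. -/
def U (q : ℂ) : Type := RingQuot (Rel q)

namespace U

variable {q : ℂ}

instance : Ring (U q) := inferInstanceAs (Ring (RingQuot (Rel q)))

instance : Algebra ℂ (U q) := inferInstanceAs (Algebra ℂ (RingQuot (Rel q)))

/-- The canonical projection from the free algebra. -/
def proj (q : ℂ) : FreeAlgebra ℂ Gen →ₐ[ℂ] U q := RingQuot.mkAlgHom ℂ (Rel q)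

/-- The class of a generator in `U q`. -/
def gen (q : ℂ) (g : Gen) : U q := proj q (Free.gen g)

/-- The generator `K`. -/
abbrev K : U q := gen q .K
/-- The generator `K̄`. -/
abbrev Kbar : U q := gen q .Kbar
/-- The generator `L`. -/
abbrev L : U q := gen q .L
/-- The generator `L̄`. -/
abbrev Lbar : U q := gen q .Lbar
/-- The generator `E`. -/
abbrev E : U q := gen q .E
/-- The generator `F`. -/
abbrev F : U q := gen q .F
/-- The idempotent `P = K K̄`. -/
abbrev P : U q := K * Kbar
/-- The idempotent `Q = L L̄`. -/
abbrev Q : U q := L * Lbar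

/-- The universal property of `U q`. -/
def lift {A : Type*} [Ring A] [Algebra ℂ A] (g : Gen → A)
    (h : ∀ x y, Rel q x y → FreeAlgebra.lift ℂ g x = FreeAlgebra.lift ℂ g y) : U q →ₐ[ℂ] A :=
  RingQuot.liftAlgHom ℂ ⟨FreeAlgebra.lift ℂ g, fun x y => h x y⟩

@[simp] lemma lift_gen {A : Type*} [Ring A] [Algebra ℂ A] (g : Gen → A)
    (h : ∀ x y, Rel q x y → FreeAlgebra.lift ℂ g x = FreeAlgebra.lift ℂ g y) (x : Gen) :
    lift g h (gen q x) = g x := by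
  refine (RingQuot.liftAlgHom_mkAlgHom_apply ℂ (FreeAlgebra.lift ℂ g) (fun x y => h x y) _).trans ?_
  exact FreeAlgebra.lift_ι_apply _ _

lemma algHom_ext {A : Type*} [Ring A] [Algebra ℂ A] {f g : U q →ₐ[ℂ] A}
    (h : ∀ x, f (gen q x) = g (gen q x)) : f = g :=
  RingQuot.ringQuot_ext' ℂ f g (FreeAlgebra.hom_ext (funext h))

lemma rel {x y : FreeAlgebra ℂ Gen} (h : Rel q x y) : proj q x = proj q y :=
  RingQuot.mkAlgHom_rel ℂ h

lemma K_Kbar_K : (K * (Kbar * K) : U q) = K := by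
  simpa [gen, mul_assoc] using rel (q := q) .K_Kbar_K

lemma Kbar_K_Kbar : (Kbar * (K * Kbar) : U q) = Kbar := by
  simpa [gen, mul_assoc] using rel (q := q) .Kbar_K_Kbar

lemma K_comm : (Kbar * K : U q) = K * Kbar := by
  simpa [gen] using (rel (q := q) .K_comm).symm

lemma L_Lbar_L : (L * (Lbar * L) : U q) = L := by
  simpa [gen, mul_assoc] using rel (q := q) .L_Lbar_L

lemma Lbar_L_Lbar : (Lbar * (L * Lbar) : U q) = Lbar := by
  simpa [gen, mul_assoc] using rel (q := q) .Lbar_L_Lbar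

lemma L_comm : (Lbar * L : U q) = L * Lbar := by
  simpa [gen] using (rel (q := q) .L_comm).symm

lemma unity : (K * Kbar + L * Lbar : U q) = 1 := by
  simpa [gen] using rel (q := q) .unity

lemma K_E : (K * E : U q) = q ^ 2 • (E * K) := by
  simpa [gen] using rel (q := q) .K_E

lemma L_E : (L * E : U q) = q ^ 2 • (E * L) := by
  simpa [gen] using rel (q := q) .L_E

lemma Kbar_E : (Kbar * E : U q) = (q ^ 2)⁻¹ • (E * Kbar) := by
  simpa only [gen, map_mul, map_smul] using rel (q := q) .Kbar_E

lemma Lbar_E : (Lbar * E : U q) = (q ^ 2)⁻¹ • (E * Lbar) := by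
  simpa only [gen, map_mul, map_smul] using rel (q := q) .Lbar_E

lemma K_F : (K * F : U q) = (q ^ 2)⁻¹ • (F * K) := by
  simpa only [gen, map_mul, map_smul] using rel (q := q) .K_F

lemma L_F : (L * F : U q) = (q ^ 2)⁻¹ • (F * L) := by
  simpa only [gen, map_mul, map_smul] using rel (q := q) .L_F

lemma Kbar_F : (Kbar * F : U q) = q ^ 2 • (F * Kbar) := by
  simpa [gen] using rel (q := q) .Kbar_F

lemma Lbar_F : (Lbar * F : U q) = q ^ 2 • (F * Lbar) := by
  simpa [gen] using rel (q := q) .Lbar_F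

lemma E_F : (E * F : U q) = F * E + (q - q⁻¹)⁻¹ • ((K + L) - (Kbar + Lbar)) := by
  have := rel (q := q) .E_F
  simp only [map_sub, map_mul, map_smul, map_add] at this
  exact sub_eq_iff_eq_add'.mp this

lemma PQ : (K * Kbar * (L * Lbar) : U q) = 0 := by
  have h : (L * Lbar : U q) = 1 - K * Kbar := by rw [← unity]; abel
  rw [h, mul_sub, mul_one, mul_assoc, Kbar_K_Kbar, sub_self]

lemma QP : (L * Lbar * (K * Kbar) : U q) = 0 := by
  have h : (L * Lbar : U q) = 1 - K * Kbar := by rw [← unity]; abel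
  rw [h, sub_mul, one_mul, mul_assoc, Kbar_K_Kbar, sub_self]

lemma P_K : (K * Kbar * K : U q) = K := by rw [mul_assoc, K_Kbar_K]
lemma K_P : (K * (K * Kbar) : U q) = K := by rw [← K_comm, K_Kbar_K]
lemma P_Kbar : (K * Kbar * Kbar : U q) = Kbar := by rw [← K_comm, mul_assoc, Kbar_K_Kbar]
lemma Q_L : (L * Lbar * L : U q) = L := by rw [mul_assoc, L_Lbar_L]
lemma L_Q : (L * (L * Lbar) : U q) = L := by rw [← L_comm, L_Lbar_L]
lemma Q_Lbar : (L * Lbar * Lbar : U q) = Lbar := by rw [← L_comm, mul_assoc, Lbar_L_Lbar]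

lemma mul_zero_of_PQ {x y : U q} (hx : x * (K * Kbar) = x) (hy : L * Lbar * y = y) :
    x * y = 0 := by
  rw [← hx, ← hy, mul_assoc, ← mul_assoc (K * Kbar), PQ, zero_mul, mul_zero]

lemma mul_zero_of_QP {x y : U q} (hx : x * (L * Lbar) = x) (hy : K * Kbar * y = y) :
    x * y = 0 := by
  rw [← hx, ← hy, mul_assoc, ← mul_assoc (L * Lbar), QP, zero_mul, mul_zero]

lemma K_L : (K * L : U q) = 0 := mul_zero_of_PQ K_P Q_L
lemma K_Lbar : (K * Lbar : U q) = 0 := mul_zero_of_PQ K_P Q_Lbar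
lemma Kbar_L : (Kbar * L : U q) = 0 := mul_zero_of_PQ Kbar_K_Kbar Q_L
lemma Kbar_Lbar : (Kbar * Lbar : U q) = 0 := mul_zero_of_PQ Kbar_K_Kbar Q_Lbar
lemma L_K : (L * K : U q) = 0 := mul_zero_of_QP L_Q P_K
lemma L_Kbar : (L * Kbar : U q) = 0 := mul_zero_of_QP L_Q P_Kbar
lemma Lbar_K : (Lbar * K : U q) = 0 := mul_zero_of_QP Lbar_L_Lbar P_K
lemma Lbar_Kbar : (Lbar * Kbar : U q) = 0 := mul_zero_of_QP Lbar_L_Lbar P_Kbar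

lemma K_Kbar_Kbar : (K * (Kbar * Kbar) : U q) = Kbar := by rw [← mul_assoc, P_Kbar]
lemma L_Lbar_Lbar : (L * (Lbar * Lbar) : U q) = Lbar := by rw [← mul_assoc, Q_Lbar]
lemma K_Q : (K * (L * Lbar) : U q) = 0 := by rw [← mul_assoc, K_L, zero_mul]
lemma Kbar_Q : (Kbar * (L * Lbar) : U q) = 0 := by rw [← mul_assoc, Kbar_L, zero_mul]
lemma L_P : (L * (K * Kbar) : U q) = 0 := by rw [← mul_assoc, L_K, zero_mul]
lemma Lbar_P : (Lbar * (K * Kbar) : U q) = 0 := by rw [← mul_assoc, Lbar_K, zero_mul]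

/-- The comultiplication on generators. -/
def comulGen (q : ℂ) : Gen → U q ⊗[ℂ] U q
  | .K => K ⊗ₜ K
  | .Kbar => Kbar ⊗ₜ Kbar
  | .L => L ⊗ₜ L + L ⊗ₜ K + K ⊗ₜ L
  | .Lbar => Lbar ⊗ₜ Lbar + Lbar ⊗ₜ Kbar + Kbar ⊗ₜ Lbar
  | .E => 1 ⊗ₜ E + E ⊗ₜ (K + L)
  | .F => F ⊗ₜ 1 + (Kbar + Lbar) ⊗ₜ F

/-- The counit on generators. -/
def counitGen : Gen → ℂ
  | .K => 1
  | .Kbar => 1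
  | .L => 0
  | .Lbar => 0
  | .E => 0
  | .F => 0

/-- The von Neumann regular antipode on generators, with values in the opposite algebra. -/
def antipodeGen (q : ℂ) : Gen → (U q)ᵐᵒᵖ
  | .K => .op Kbar
  | .Kbar => .op K
  | .L => .op Lbar
  | .Lbar => .op L
  | .E => .op (-(E * (Kbar + Lbar)))
  | .F => .op (-((K + L) * F))

lemma counitGen_rel (x y : FreeAlgebra ℂ Gen) (h : Rel q x y) :
    FreeAlgebra.lift ℂ counitGen x = FreeAlgebra.lift ℂ counitGen y := by
  cases h <;> simp [counitGen]

lemma comulGen_rel (x y : FreeAlgebra ℂ Gen) (h : Rel q x y) :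
    FreeAlgebra.lift ℂ (comulGen q) x = FreeAlgebra.lift ℂ (comulGen q) y := by
  cases h
  case unity =>
    simp only [map_add, map_mul, map_one, FreeAlgebra.lift_ι_apply, comulGen, add_mul, mul_add,
      Algebra.TensorProduct.tmul_mul_tmul, K_Lbar, L_Kbar, TensorProduct.tmul_zero,
      TensorProduct.zero_tmul, add_zero, zero_add, Algebra.TensorProduct.one_def]
    rw [← unity]
    simp only [TensorProduct.tmul_add, TensorProduct.add_tmul]
    abel
  case E_F =>
    have h1 : ((Kbar + Lbar) * E : U q) = (q ^ 2)⁻¹ • (E * (Kbar + Lbar)) := by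
      rw [add_mul, mul_add, Kbar_E, Lbar_E, smul_add]
    have h2 : ((K + L) * F : U q) = (q ^ 2)⁻¹ • (F * (K + L)) := by
      rw [add_mul, mul_add, K_F, L_F, smul_add]
    have hk : FreeAlgebra.lift ℂ (comulGen q) (Free.gen .K + Free.gen .L)
        = (K + L : U q) ⊗ₜ[ℂ] (K + L : U q) := by
      simp only [map_add, FreeAlgebra.lift_ι_apply, comulGen, TensorProduct.tmul_add,
        TensorProduct.add_tmul]
      abel
    have hk' : FreeAlgebra.lift ℂ (comulGen q) (Free.gen .Kbar + Free.gen .Lbar)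
        = (Kbar + Lbar : U q) ⊗ₜ[ℂ] (Kbar + Lbar : U q) := by
      simp only [map_add, FreeAlgebra.lift_ι_apply, comulGen, TensorProduct.tmul_add,
        TensorProduct.add_tmul]
      abel
    rw [map_smul, map_sub, map_sub, hk, hk']
    simp only [map_mul, FreeAlgebra.lift_ι_apply, comulGen]
    have h3 := E_F (q := q)
    generalize (K + L : U q) = k at *
    generalize (Kbar + Lbar : U q) = k' at *
    simp only [add_mul, mul_add, Algebra.TensorProduct.tmul_mul_tmul, h1, h2, h3, one_mul,
      mul_one, TensorProduct.tmul_add, TensorProduct.add_tmul, TensorProduct.tmul_smul,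
      TensorProduct.smul_tmul', TensorProduct.tmul_sub, TensorProduct.sub_tmul, smul_sub]
    abel
  all_goals
    simp only [map_mul, map_smul, FreeAlgebra.lift_ι_apply, comulGen, add_mul, mul_add,
      mul_assoc, mul_one, one_mul,
      Algebra.TensorProduct.tmul_mul_tmul, K_L, K_Lbar, L_K, L_Kbar, Kbar_L, Kbar_Lbar, Lbar_K,
      Lbar_Kbar, K_comm, L_comm, K_P, Kbar_K_Kbar, L_Q, Lbar_L_Lbar, K_Q, Kbar_Q, L_P, Lbar_P,
      K_E, L_E, Kbar_E, Lbar_E,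
      K_F, L_F, Kbar_F, Lbar_F, TensorProduct.tmul_zero, TensorProduct.tmul_add,
      TensorProduct.add_tmul, TensorProduct.tmul_smul, TensorProduct.smul_tmul', smul_add,
      TensorProduct.zero_tmul, add_zero, zero_add] <;>
    try abel1

lemma E_eq_zero (hq : q = 0) : (E : U q) = 0 := by
  have h1 : (K * E : U q) = 0 := by rw [K_E]; simp [hq]
  have h2 : (L * E : U q) = 0 := by rw [L_E]; simp [hq]
  rw [← one_mul E, ← unity, add_mul, ← K_comm, ← L_comm, mul_assoc, mul_assoc, h1, h2]
  simp

lemma F_eq_zero (hq : q = 0) : (F : U q) = 0 := by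
  have h1 : (K * F : U q) = 0 := by rw [K_F]; simp [hq]
  have h2 : (L * F : U q) = 0 := by rw [L_F]; simp [hq]
  rw [← one_mul F, ← unity, add_mul, ← K_comm, ← L_comm, mul_assoc, mul_assoc, h1, h2]
  simp

lemma antipodeGen_rel (x y : FreeAlgebra ℂ Gen) (h : Rel q x y) :
    FreeAlgebra.lift ℂ (antipodeGen q) x = FreeAlgebra.lift ℂ (antipodeGen q) y := by
  apply MulOpposite.unop_injective
  by_cases hq : q = 0
  · have hE := E_eq_zero hq
    have hF := F_eq_zero hq
    cases h
    case E_F => simp [hq, antipodeGen, hE]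
    case unity => simpa [antipodeGen, K_comm, L_comm] using unity (q := q)
    all_goals
      simp [antipodeGen, hE, hF, mul_assoc, K_comm, L_comm, K_P, L_Q, K_Kbar_Kbar, L_Lbar_Lbar]
  · have hq2 : q ^ 2 ≠ 0 := pow_ne_zero 2 hq
    cases h
    case unity => simpa [antipodeGen, K_comm, L_comm] using unity (q := q)
    case E_F =>
      have h1 : ((Kbar + Lbar) * F : U q) = q ^ 2 • (F * (Kbar + Lbar)) := by
        rw [add_mul, mul_add, Kbar_F, Lbar_F, smul_add]
      have h2 : ((K + L) * F : U q) = (q ^ 2)⁻¹ • (F * (K + L)) := by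
        rw [add_mul, mul_add, K_F, L_F, smul_add]
      have h3 : ((K + L) * E : U q) = q ^ 2 • (E * (K + L)) := by
        rw [add_mul, mul_add, K_E, L_E, smul_add]
      have h4 : ((K + L) * (Kbar + Lbar) : U q) = 1 := by
        simp [add_mul, mul_add, K_Lbar, L_Kbar, unity]
      have h5 : ((Kbar + Lbar) * (K + L) : U q) = 1 := by
        simp [add_mul, mul_add, Kbar_L, Lbar_K, K_comm, L_comm, unity]
      have h6 := E_F (q := q)
      simp only [map_sub, map_mul, map_smul, map_add, FreeAlgebra.lift_ι_apply, antipodeGen,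
        ← MulOpposite.op_add, ← MulOpposite.op_mul, ← MulOpposite.op_sub, ← MulOpposite.op_smul,
        MulOpposite.unop_op]
      generalize (K + L : U q) = k at *
      generalize (Kbar + Lbar : U q) = k' at *
      have e1 : k * F * (E * k') = F * E := by
        rw [h2, smul_mul_assoc, mul_assoc F k, ← mul_assoc k E, h3, smul_mul_assoc, mul_smul_comm,
          smul_smul, inv_mul_cancel₀ hq2, one_smul, mul_assoc E, h4, mul_one]
      have e2 : E * k' * (k * F) = E * F := by
        rw [mul_assoc, ← mul_assoc k', h5, one_mul]
      rw [neg_mul_neg, neg_mul_neg, e1, e2, h6, smul_sub, smul_sub]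
      abel
    all_goals
      simp only [map_mul, map_smul, FreeAlgebra.lift_ι_apply, antipodeGen,
        ← MulOpposite.op_mul, ← MulOpposite.op_smul, MulOpposite.unop_op, neg_mul, mul_neg,
        smul_neg, ← mul_assoc]
      simp only [add_mul, mul_add, mul_assoc, K_L, L_K, Kbar_L, Kbar_Lbar, Lbar_K,
        Lbar_Kbar, K_comm, L_comm, K_P, L_Q, K_Kbar_Kbar, L_Lbar_Lbar, add_zero, zero_add,
        mul_zero, smul_add]
      try simp only [← mul_assoc, K_E, L_E, Kbar_E, Lbar_E, K_F, L_F, Kbar_F, Lbar_F,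
        smul_mul_assoc, smul_smul, inv_mul_cancel₀ hq2, mul_inv_cancel₀ hq2, one_smul]
      try simp only [mul_assoc, mul_smul_comm, K_Lbar, L_Kbar, Kbar_Lbar, Lbar_Kbar,
        mul_zero, smul_zero, add_zero, zero_add]
      try simp only [← mul_assoc, K_F, L_F, smul_mul_assoc]
      try simp only [mul_assoc, K_L, L_K, mul_zero, smul_zero, add_zero, zero_add, smul_smul,
        mul_inv_cancel_left₀ hq2, mul_inv_cancel₀ hq2, one_smul]

/-- The comultiplication. -/
def comulHom (q : ℂ) : U q →ₐ[ℂ] U q ⊗[ℂ] U q := lift (comulGen q) comulGen_rel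

/-- The counit. -/
def counitHom (q : ℂ) : U q →ₐ[ℂ] ℂ := lift counitGen counitGen_rel

/-- The bialgebra structure. -/
instance : Bialgebra ℂ (U q) :=
  Bialgebra.ofAlgHom (comulHom q) (counitHom q)
    (by
      refine algHom_ext fun x => ?_
      cases x <;> simp [comulHom, comulGen, TensorProduct.add_tmul, TensorProduct.tmul_add,
        Algebra.TensorProduct.one_def] <;> abel)
    (by
      refine algHom_ext fun x => ?_
      cases x <;> simp [comulHom, comulGen, counitHom, counitGen])
    (by
      refine algHom_ext fun x => ?_
      cases x <;> simp [comulHom, comulGen, counitHom, counitGen])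

/-- The antimorphism `T` with `T(K) = K̄`, `T(K̄) = K`, `T(L) = L̄`, `T(L̄) = L`,
`T(E) = -E(K̄ + L̄)`, `T(F) = -(K + L)F`. -/
def antipode (q : ℂ) : U q →ₗ[ℂ] U q :=
  (MulOpposite.opLinearEquiv ℂ).symm.toLinearMap ∘ₗ
    (lift (antipodeGen q) antipodeGen_rel).toLinearMap

end U

/-! ### von Neumann regular antipodes and universal R-matrices -/

section General

variable {A : Type*} [Ring A] [Bialgebra ℂ A]

/-- The convolution `f ⋆ g = μ ∘ (f ⊗ g) ∘ Δ`. -/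
def convolution (f g : A →ₗ[ℂ] A) : A →ₗ[ℂ] A :=
  LinearMap.mul' ℂ A ∘ₗ TensorProduct.map f g ∘ₗ Coalgebra.comul

/-- `T` is an antimorphism of algebras with `id ⋆ T ⋆ id = id` and `T ⋆ id ⋆ T = T`. A bialgebra
together with such a `T` is a von Neumann–Hopf algebra. -/
structure IsVonNeumannAntipode (T : A →ₗ[ℂ] A) : Prop where
  map_one : T 1 = 1
  map_mul : ∀ x y, T (x * y) = T y * T x
  id_conv : convolution (convolution LinearMap.id T) LinearMap.id = LinearMap.id
  conv_id : convolution (convolution T LinearMap.id) T = T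

/-- `R₁₂ = ∑ s ⊗ t ⊗ 1` for `R = ∑ s ⊗ t`. -/
def leg12 : A ⊗[ℂ] A →ₐ[ℂ] A ⊗[ℂ] (A ⊗[ℂ] A) :=
  Algebra.TensorProduct.map (AlgHom.id ℂ A) Algebra.TensorProduct.includeLeft

/-- `R₁₃ = ∑ s ⊗ 1 ⊗ t` for `R = ∑ s ⊗ t`. -/
def leg13 : A ⊗[ℂ] A →ₐ[ℂ] A ⊗[ℂ] (A ⊗[ℂ] A) :=
  Algebra.TensorProduct.map (AlgHom.id ℂ A) Algebra.TensorProduct.includeRight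

/-- `R₂₃ = ∑ 1 ⊗ s ⊗ t` for `R = ∑ s ⊗ t`. -/
def leg23 : A ⊗[ℂ] A →ₐ[ℂ] A ⊗[ℂ] (A ⊗[ℂ] A) :=
  Algebra.TensorProduct.includeRight

/-- `R` is a universal R-matrix making the bialgebra `A` braided: `R` is invertible,
`Δᶜᵒᵖ(b) = R Δ(b) R⁻¹` for all `b`, `(Δ ⊗ id)(R) = R₁₃ R₂₃` and `(id ⊗ Δ)(R) = R₁₃ R₁₂`. -/
structure IsUniversalRMatrix (R : A ⊗[ℂ] A) : Prop where
  comul_cop : ∃ R' : A ⊗[ℂ] A, R * R' = 1 ∧ R' * R = 1 ∧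
    ∀ b : A, TensorProduct.comm ℂ A A (Coalgebra.comul b) = R * Coalgebra.comul b * R'
  comul_id : TensorProduct.assoc ℂ A A A
    (TensorProduct.map Coalgebra.comul LinearMap.id R) = leg13 R * leg23 R
  id_comul : TensorProduct.map LinearMap.id Coalgebra.comul R = leg13 R * leg12 R

end General

/-! ### The quotient and the R-matrix -/

/-- The two-sided ideal of `U q` generated by `K ^ n + L ^ n - 1`, `E ^ n` and `F ^ n`. -/
abbrev ideal (n : ℕ) (q : ℂ) : Ideal (U q) :=
  (TwoSidedIdeal.span {U.K ^ n + U.L ^ n - 1, U.E ^ n, U.F ^ n}).asIdeal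

/-- The quotient algebra `Û` of `U q` by `ideal n q`. -/
abbrev UHat (n : ℕ) (q : ℂ) : Type := U q ⧸ ideal n q

/-- The `q`-integer `[m] = (q ^ m - q ^ (-m)) / (q - q⁻¹)`. -/
def qInt (q : ℂ) (m : ℕ) : ℂ := (q ^ m - (q ^ m)⁻¹) / (q - q⁻¹)

/-- The `q`-factorial `[m]! = [1] [2] ⋯ [m]`. -/
def qFactorial (q : ℂ) (m : ℕ) : ℂ := ∏ k ∈ Finset.Icc 1 m, qInt q k

/-- The coefficient `A_m^{ij}(q)`. -/
def coeffA (n : ℕ) (q : ℂ) (m i j : ℕ) : ℂ :=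
  1 / n * ((q - q⁻¹) ^ m / qFactorial q m) *
    q ^ ((m.choose 2 : ℤ) + 2 * m * ((i : ℤ) - j) - 2 * i * j)

/-- The element `K ^ i + L ^ i` of `U q`; here `K` and `L` live in the corners with units `P` and
`Q`, so that `K ^ 0 = P` and `L ^ 0 = Q`. -/
def cartanPow (q : ℂ) (i : ℕ) : U q := U.P * U.K ^ i + U.Q * U.L ^ i

lemma cartanPow_zero (q : ℂ) : cartanPow q 0 = 1 := by
  simp [cartanPow, U.unity]

lemma cartanPow_of_ne_zero (q : ℂ) {i : ℕ} (hi : i ≠ 0) :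
    cartanPow q i = U.K ^ i + U.L ^ i := by
  obtain ⟨j, rfl⟩ := Nat.exists_eq_succ_of_ne_zero hi
  rw [cartanPow, pow_succ', pow_succ', ← mul_assoc, ← mul_assoc, U.P_K, U.Q_L]

/-- The element `∑ A_m^{ij}(q) E^m (K^i + L^i) ⊗ F^m (K^j + L^j)` of `Û ⊗ Û`, where `i, j, m` run
from `0` to `n - 1`. -/
def rMatrix (n : ℕ) (q : ℂ) : UHat n q ⊗[ℂ] UHat n q :=
  ∑ i ∈ Finset.range n, ∑ j ∈ Finset.range n, ∑ m ∈ Finset.range n,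
    coeffA n q m i j •
      (Ideal.Quotient.mk (ideal n q) (U.E ^ m * cartanPow q i) ⊗ₜ[ℂ]
        Ideal.Quotient.mk (ideal n q) (U.F ^ m * cartanPow q j))

end VNHopf

end

/-!
Put `k = K + L` and `k' = K̄ + L̄`. These are mutually inverse and group-like, and `P = K K̄` is a
central idempotent with `Δ(P) = P ⊗ P`. Since `k ^ i = K ^ i + L ^ i`, the elements `k`, `E`, `F` of
the quotient satisfy the relations of the small quantum group of `sl₂`, and the element in question
is its usual R-matrix. Throughout, `p = q⁻²`, which is a primitive `n`-th root of unity because `n`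
is odd.

*The ideal is a coideal.* `Δ(E)` and `Δ(F)` are sums of two elements that commute up to `p` and have
vanishing `n`-th powers in the quotient. By the `p`-binomial formula and `(n)_p = 0` the `n`-th
power of such a sum vanishes (`add_pow_eq_zero_of_mul_eq_smul`).

*The antipode.* The values of `id ⋆ T` and `T ⋆ id` on the generators are `P`, `1 - P` or `0`, all
central. Hence `id ⋆ T` and `T ⋆ id` are algebra morphisms, and the regularity identities have to be
checked on generators only (`IsVonNeumannAntipode.of_adjoin_eq_top`).

*The R-matrix.* Moving `k ^ i ⊗ k ^ j` to the left factorizes it as `C Θ` (`rMatrix_eq`), where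
`C = 1 / n ∑ p ^ (i j) k ^ i ⊗ k ^ j` is a bicharacter of the cyclic group generated by `k` and
`Θ = ∑ ((q - q⁻¹) E ⊗ F) ^ m / (m)_p!` is a truncated `p`-exponential. Conjugation by `C` multiplies
`E` and `F` in one leg by a power of `k` in the other (`bichar_mul_of_mul_eq_smul`,
`mul_bichar_of_mul_eq_smul`). Therefore both hexagon identities follow from the bimultiplicativity
of `C` (`bichar_mul_left`) and the addition theorem for the `p`-exponential (`gaussExp_add`), in
which the terms lost by truncation contain `E ^ n` or `F ^ n`. The relation between `Δᶜᵒᵖ` and `Δ`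
is checked on generators; for `E` and `F` it amounts to the commutator of `E` with powers of `F`
(`gaussExp_intertwines`). Finally `C` is invertible as a bicharacter, and `Θ` is unipotent.
-/

noncomputable section

namespace VNHopf

/-! ### The truncated `p`-exponential at a root of unity -/

section GaussExp

variable {𝕜 : Type*} [Field 𝕜]

/-- The Gauss integer `(m)_p = 1 + p + ⋯ + p ^ (m - 1)`. -/
def gaussInt (p : 𝕜) (m : ℕ) : 𝕜 := ∑ r ∈ Finset.range m, p ^ r

/-- The Gauss factorial `(m)_p! = (1)_p (2)_p ⋯ (m)_p`. -/
def gaussFactorial (p : 𝕜) (m : ℕ) : 𝕜 := ∏ k ∈ Finset.range m, gaussInt p (k + 1)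

lemma gaussInt_zero (p : 𝕜) : gaussInt p 0 = 0 := by simp [gaussInt]

lemma gaussInt_succ (p : 𝕜) (m : ℕ) : gaussInt p (m + 1) = gaussInt p m + p ^ m :=
  Finset.sum_range_succ _ _

lemma gaussInt_add (p : 𝕜) (a b : ℕ) :
    gaussInt p (a + b) = gaussInt p a + p ^ a * gaussInt p b := by
  simp [gaussInt, Finset.sum_range_add, Finset.mul_sum, pow_add]

lemma gaussInt_mul (p : 𝕜) (m : ℕ) : gaussInt p m * (p - 1) = p ^ m - 1 := geom_sum_mul p m

lemma gaussInt_ne_zero {p : 𝕜} {n m : ℕ} (hp : IsPrimitiveRoot p n) (h0 : m ≠ 0) (hm : m < n) :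
    gaussInt p m ≠ 0 := by
  intro h
  have h1 := gaussInt_mul p m
  rw [h, zero_mul] at h1
  exact hp.pow_ne_one_of_pos_of_lt h0 hm (sub_eq_zero.mp h1.symm)

lemma gaussInt_eq_zero {p : 𝕜} {n : ℕ} (hp : IsPrimitiveRoot p n) (hn : 1 < n) :
    gaussInt p n = 0 := by
  have h1 := gaussInt_mul p n
  rw [hp.pow_eq_one, sub_self] at h1
  exact (mul_eq_zero.mp h1).resolve_right (sub_ne_zero.mpr (hp.ne_one hn))

lemma gaussFactorial_zero (p : 𝕜) : gaussFactorial p 0 = 1 := by simp [gaussFactorial]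

lemma gaussFactorial_succ (p : 𝕜) (m : ℕ) :
    gaussFactorial p (m + 1) = gaussFactorial p m * gaussInt p (m + 1) :=
  Finset.prod_range_succ _ _

lemma gaussFactorial_ne_zero {p : 𝕜} {n m : ℕ} (hp : IsPrimitiveRoot p n) (hm : m < n) :
    gaussFactorial p m ≠ 0 := by
  refine Finset.prod_ne_zero_iff.mpr fun k hk => gaussInt_ne_zero hp (Nat.succ_ne_zero k) ?_
  have := Finset.mem_range.mp hk
  omega

variable {B : Type*} [Ring B] [Algebra 𝕜 B]

/-- The divided power `X ^ m / (m)_p!`. It is `0` where `(m)_p! = 0`, which at a primitive `n`-th root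
of unity `p ≠ 1` happens exactly for `n ≤ m`. -/
def gaussPow (p : 𝕜) (X : B) (m : ℕ) : B := (gaussFactorial p m)⁻¹ • X ^ m

lemma gaussPow_zero (p : 𝕜) (X : B) : gaussPow p X 0 = 1 := by
  simp [gaussPow, gaussFactorial_zero]

/-- For `a + 1 = n` both sides vanish: the left one because `X ^ n = 0`, the right one because
`(n)_p = 0`. This is what makes the truncated theory run up to and including degree `n`. -/
lemma mul_gaussPow {p : 𝕜} {n : ℕ} (hp : IsPrimitiveRoot p n) (hn : 1 < n) {X : B}
    (hX : X ^ n = 0) {a : ℕ} (ha : a < n) :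
    X * gaussPow p X a = gaussInt p (a + 1) • gaussPow p X (a + 1) := by
  rw [gaussPow, mul_smul_comm, ← pow_succ']
  rcases (Nat.succ_le_of_lt ha).eq_or_lt with h | h
  · have h' : a + 1 = n := h
    rw [h', hX, gaussInt_eq_zero hp hn, zero_smul, smul_zero]
  · rw [gaussPow, smul_smul, gaussFactorial_succ, mul_inv, mul_comm, mul_assoc,
      inv_mul_cancel₀ (gaussInt_ne_zero hp (Nat.succ_ne_zero a) h), mul_one]

lemma mul_pow_of_mul_eq_smul {p : 𝕜} {X Y : B} (h : X * Y = p • (Y * X)) (m : ℕ) :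
    X * Y ^ m = p ^ m • (Y ^ m * X) := by
  induction m with
  | zero => simp
  | succ m ih =>
    rw [pow_succ, ← mul_assoc, ih, smul_mul_assoc, mul_assoc, h, mul_smul_comm, smul_smul,
      ← pow_succ, ← mul_assoc]

lemma pow_mul_pow_of_mul_eq_smul {p : 𝕜} {X Y : B} (h : X * Y = p • (Y * X)) (i m : ℕ) :
    X ^ i * Y ^ m = p ^ (i * m) • (Y ^ m * X ^ i) := by
  induction i with
  | zero => simp
  | succ i ih =>
    rw [pow_succ', mul_assoc, ih, mul_smul_comm, ← mul_assoc, mul_pow_of_mul_eq_smul h,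
      smul_mul_assoc, smul_smul, mul_assoc, ← pow_add, add_mul, one_mul]

lemma pow_mul_of_mul_eq_smul {p : 𝕜} {X Y : B} (h : X * Y = p • (Y * X)) (i : ℕ) :
    X ^ i * Y = p ^ i • (Y * X ^ i) := by
  simpa using pow_mul_pow_of_mul_eq_smul h i 1

/-- If two elements commute up to a scalar and one of them is nilpotent, then so is their
product. -/
lemma mul_pow_eq_zero_of_mul_eq_smul {c : 𝕜} {x y : B} (h : y * x = c • (x * y)) {n : ℕ}
    (hx : x ^ n = 0) : (x * y) ^ n = 0 := by
  have h1 : ∀ m : ℕ, ∃ d : 𝕜, (x * y) ^ m = d • (x ^ m * y ^ m) := by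
    intro m
    induction m with
    | zero => exact ⟨1, by simp⟩
    | succ m ih =>
      obtain ⟨d, hd⟩ := ih
      refine ⟨d * c ^ m, ?_⟩
      rw [pow_succ', hd, mul_smul_comm, mul_assoc, ← mul_assoc y, mul_pow_of_mul_eq_smul h,
        smul_mul_assoc, mul_smul_comm, smul_smul, mul_assoc, ← pow_succ', ← mul_assoc,
        ← pow_succ']
  obtain ⟨d, hd⟩ := h1 n
  rw [hd, hx, zero_mul, smul_zero]

/-- The `p`-binomial formula in divided power form. It holds up to and including `m = n`, where
both sides vanish. -/
lemma gaussPow_add {p : 𝕜} {n : ℕ} (hp : IsPrimitiveRoot p n) (hn : 1 < n) {X Y : B}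
    (hX : X ^ n = 0) (hY : Y ^ n = 0) (h : X * Y = p • (Y * X)) {m : ℕ} (hm : m ≤ n) :
    (X + Y) ^ m = gaussFactorial p m •
      ∑ ij ∈ Finset.HasAntidiagonal.antidiagonal m, gaussPow p Y ij.1 * gaussPow p X ij.2 := by
  induction m with
  | zero => simp [gaussFactorial_zero, gaussPow_zero]
  | succ m ih =>
    have hmn : m < n := hm
    rw [pow_succ', ih hmn.le, mul_smul_comm, gaussFactorial_succ, mul_smul]
    congr 1
    have e1 : ∀ ij ∈ Finset.HasAntidiagonal.antidiagonal m,
        (X + Y) * (gaussPow p Y ij.1 * gaussPow p X ij.2) =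
          gaussInt p (ij.1 + 1) • (gaussPow p Y (ij.1 + 1) * gaussPow p X ij.2) +
          (p ^ ij.1 * gaussInt p (ij.2 + 1)) •
            (gaussPow p Y ij.1 * gaussPow p X (ij.2 + 1)) := by
      rintro ⟨i, j⟩ hij
      have hij' : i + j = m := Finset.HasAntidiagonal.mem_antidiagonal.mp hij
      have e2 : X * gaussPow p Y i = p ^ i • (gaussPow p Y i * X) := by
        rw [gaussPow, mul_smul_comm, mul_pow_of_mul_eq_smul h, smul_comm, smul_mul_assoc]
      dsimp only
      rw [add_mul, ← mul_assoc, ← mul_assoc, mul_gaussPow hp hn hY (by omega), e2,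
        smul_mul_assoc, mul_assoc, mul_gaussPow hp hn hX (by omega), mul_smul_comm, smul_smul,
        smul_mul_assoc, add_comm]
    rw [Finset.mul_sum, Finset.sum_congr rfl e1, Finset.sum_add_distrib, Finset.smul_sum]
    have e3 : ∀ ij ∈ Finset.HasAntidiagonal.antidiagonal (m + 1),
        gaussInt p (m + 1) • (gaussPow p Y ij.1 * gaussPow p X ij.2) =
          gaussInt p ij.1 • (gaussPow p Y ij.1 * gaussPow p X ij.2) +
          (p ^ ij.1 * gaussInt p ij.2) • (gaussPow p Y ij.1 * gaussPow p X ij.2) := by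
      rintro ⟨i, j⟩ hij
      have hij' : i + j = m + 1 := Finset.HasAntidiagonal.mem_antidiagonal.mp hij
      rw [← hij', gaussInt_add, add_smul]
    rw [Finset.sum_congr rfl e3, Finset.sum_add_distrib, Finset.Nat.sum_antidiagonal_succ,
      Finset.Nat.sum_antidiagonal_succ' (f := fun ij : ℕ × ℕ =>
        (p ^ ij.1 * gaussInt p ij.2) • (gaussPow p Y ij.1 * gaussPow p X ij.2))]
    simp [gaussInt_zero]

lemma add_pow_eq_zero_of_mul_eq_smul {p : 𝕜} {n : ℕ} (hp : IsPrimitiveRoot p n) (hn : 1 < n)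
    {X Y : B} (hX : X ^ n = 0) (hY : Y ^ n = 0) (h : X * Y = p • (Y * X)) : (X + Y) ^ n = 0 := by
  obtain ⟨m, rfl⟩ := Nat.exists_eq_succ_of_ne_zero (by omega : n ≠ 0)
  rw [gaussPow_add hp hn hX hY h le_rfl, Nat.succ_eq_add_one, gaussFactorial_succ,
    gaussInt_eq_zero hp hn, mul_zero, zero_smul]

/-- The truncated `p`-exponential `∑ X ^ m / (m)_p!`, where `m` runs from `0` to `n - 1`. -/
def gaussExp (p : 𝕜) (n : ℕ) (X : B) : B := ∑ m ∈ Finset.range n, gaussPow p X m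

lemma map_gaussExp {B' : Type*} [Ring B'] [Algebra 𝕜 B'] (f : B →ₐ[𝕜] B') (p : 𝕜) (n : ℕ)
    (X : B) : f (gaussExp p n X) = gaussExp p n (f X) := by
  simp [gaussExp, gaussPow]

/-- A truncated `p`-exponential is multiplicative on `p`-commuting elements as soon as the
products of degree at least `n` vanish. -/
lemma gaussExp_add {p : 𝕜} {n : ℕ} (hp : IsPrimitiveRoot p n) (hn : 1 < n) {X Y : B}
    (h : X * Y = p • (Y * X)) (hXY : ∀ i j, n ≤ i + j → Y ^ i * X ^ j = 0) :
    gaussExp p n (X + Y) = gaussExp p n Y * gaussExp p n X := by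
  have hX : X ^ n = 0 := by simpa using hXY 0 n (by omega)
  have hY : Y ^ n = 0 := by simpa using hXY n 0 (by omega)
  have e1 : gaussExp p n (X + Y) = ∑ m ∈ Finset.range n, ∑ i ∈ Finset.range (m + 1),
      gaussPow p Y i * gaussPow p X (m - i) := by
    refine Finset.sum_congr rfl fun m hm => ?_
    have hm' := Finset.mem_range.mp hm
    rw [gaussPow, gaussPow_add hp hn hX hY h hm'.le, smul_smul,
      inv_mul_cancel₀ (gaussFactorial_ne_zero hp hm'), one_smul,
      Finset.Nat.sum_antidiagonal_eq_sum_range_succ (fun i j => gaussPow p Y i * gaussPow p X j)]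
  rw [e1, Finset.sum_range_diag_flip n (fun i j => gaussPow p Y i * gaussPow p X j), gaussExp,
    gaussExp, Finset.sum_mul_sum]
  refine Finset.sum_congr rfl fun i _ => ?_
  refine Finset.sum_subset (Finset.range_mono (Nat.sub_le n i)) fun j _ hj => ?_
  have hj' : n ≤ i + j := by
    have := mt Finset.mem_range.mpr hj
    omega
  rw [gaussPow, gaussPow, smul_mul_smul_comm, hXY i j hj', smul_zero]

lemma mul_pow_succ_of_commutator {p : 𝕜} {a u v X : B} (ha : a * X = X * a + (u - v))
    (hu : u * X = p • (X * u)) (hv : X * v = p • (v * X)) (m : ℕ) :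
    a * X ^ (m + 1) = X ^ (m + 1) * a + gaussInt p (m + 1) • (X ^ m * u - v * X ^ m) := by
  induction m with
  | zero => simp [gaussInt, ha]
  | succ m ih =>
    have e1 : gaussInt p (m + 1 + 1) = 1 + p * gaussInt p (m + 1) := by
      rw [add_comm, gaussInt_add]; simp [gaussInt]
    have e2 : X ^ m * u * X = p • (X ^ (m + 1) * u) := by
      rw [mul_assoc, hu, mul_smul_comm, ← mul_assoc, pow_succ]
    have e3 : a * X ^ (m + 1 + 1) = X ^ (m + 1) * (a * X) +
        gaussInt p (m + 1) • (X ^ m * u * X - v * X ^ (m + 1)) := by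
      rw [pow_succ X (m + 1), ← mul_assoc, ih, add_mul, mul_assoc, smul_mul_assoc, sub_mul,
        mul_assoc v, ← pow_succ]
    rw [e3, ha, e2, mul_add, ← mul_assoc, ← pow_succ, add_assoc, mul_sub,
      pow_mul_of_mul_eq_smul hv, smul_sub, smul_sub]
    congr 1
    nth_rw 1 [e1]
    rw [gaussInt_succ p (m + 1), add_smul, add_smul, smul_smul, one_smul, mul_comm p]
    abel

/-- If the commutator of `a` and `X` is `u - v` and the elements `u`, `v` and `X` commute up to
powers of `p`, then the truncated `p`-exponential of `X` intertwines `a + u` and `a + v`. -/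
lemma gaussExp_intertwines {p : 𝕜} {n : ℕ} (hp : IsPrimitiveRoot p n) (hn : 1 < n) {a u v X : B}
    (ha : a * X = X * a + (u - v)) (hu : u * X = p • (X * u)) (hv : X * v = p • (v * X))
    (hXu : X ^ (n - 1) * u = 0) (hvX : v * X ^ (n - 1) = 0) :
    (a + v) * gaussExp p n X = gaussExp p n X * (a + u) := by
  obtain ⟨N, rfl⟩ := Nat.exists_eq_succ_of_ne_zero (by omega : n ≠ 0)
  rw [Nat.succ_eq_add_one, Nat.add_sub_cancel] at hXu hvX
  have e0 : ∀ m ∈ Finset.range N, a * gaussPow p X (m + 1) =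
      gaussPow p X (m + 1) * a + (gaussPow p X m * u - v * gaussPow p X m) := by
    intro m hm
    have h1 := gaussInt_ne_zero hp (Nat.succ_ne_zero m) (Nat.succ_lt_succ (Finset.mem_range.mp hm))
    rw [gaussPow, mul_smul_comm, mul_pow_succ_of_commutator ha hu hv, smul_add, smul_mul_assoc,
      smul_smul, gaussFactorial_succ, mul_inv, mul_assoc, inv_mul_cancel₀ h1, mul_one, gaussPow,
      smul_mul_assoc, mul_smul_comm, smul_sub]
  have e1 : a * gaussExp p (N + 1) X = gaussExp p (N + 1) X * a +
      ((∑ m ∈ Finset.range N, gaussPow p X m) * u -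
        v * ∑ m ∈ Finset.range N, gaussPow p X m) := by
    rw [gaussExp, Finset.sum_range_succ', mul_add, add_mul, Finset.mul_sum,
      Finset.sum_congr rfl e0, Finset.sum_add_distrib, Finset.sum_sub_distrib, Finset.sum_mul,
      Finset.sum_mul, Finset.mul_sum, gaussPow_zero, mul_one, one_mul]
    abel
  have e2 : gaussExp p (N + 1) X * u = (∑ m ∈ Finset.range N, gaussPow p X m) * u := by
    rw [gaussExp, Finset.sum_range_succ, add_mul, gaussPow, smul_mul_assoc, hXu, smul_zero,
      add_zero]
  have e3 : v * gaussExp p (N + 1) X = v * ∑ m ∈ Finset.range N, gaussPow p X m := by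
    rw [gaussExp, Finset.sum_range_succ, mul_add, gaussPow, mul_smul_comm, hvX, smul_zero,
      add_zero]
  rw [Nat.succ_eq_add_one, add_mul, mul_add, e1, e2, e3]
  abel

lemma isUnit_gaussExp (p : 𝕜) {n : ℕ} (hn : n ≠ 0) {X : B} (hX : X ^ n = 0) :
    IsUnit (gaussExp p n X) := by
  obtain ⟨N, rfl⟩ := Nat.exists_eq_succ_of_ne_zero hn
  have e1 : gaussExp p (N + 1) X =
      1 + X * ∑ m ∈ Finset.range N, (gaussFactorial p (m + 1))⁻¹ • X ^ m := by
    rw [gaussExp, Finset.sum_range_succ', gaussPow_zero, add_comm, Finset.mul_sum]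
    simp [gaussPow, pow_succ']
  rw [Nat.succ_eq_add_one, e1]
  refine IsNilpotent.isUnit_one_add (Commute.isNilpotent_mul_right ?_ ⟨_, hX⟩)
  exact Commute.sum_right _ _ _ fun m _ => ((Commute.refl X).pow_right m).smul_right _

lemma commute_gaussExp (p : 𝕜) (n : ℕ) {t X : B} (h : Commute t X) :
    Commute t (gaussExp p n X) :=
  Commute.sum_right _ _ _ fun m _ => (h.pow_right m).smul_right _

lemma gaussExp_semiconj (p : 𝕜) (n : ℕ) {t X Y : B} (h : SemiconjBy t X Y) :
    SemiconjBy t (gaussExp p n X) (gaussExp p n Y) := by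
  simp only [SemiconjBy, gaussExp, gaussPow, Finset.mul_sum, Finset.sum_mul, mul_smul_comm,
    smul_mul_assoc]
  exact Finset.sum_congr rfl fun m _ => by rw [(h.pow_right m).eq]

end GaussExp

/-! ### The bicharacter of two commuting elements of finite order -/

section Cartan

variable {𝕜 : Type*} [Field 𝕜] {B : Type*} [Ring B] [Algebra 𝕜 B]

/-- `1 / n ∑ p ^ (i j) y ^ j`: for `y ^ n = 1`, the projection onto the `p ^ (-i)`-eigenspace of
`y`. -/
def eigenProj (p : 𝕜) (n : ℕ) (y : B) (i : ℕ) : B :=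
  (n : 𝕜)⁻¹ • ∑ j ∈ Finset.range n, p ^ (i * j) • y ^ j

/-- The element `1 / n ∑ p ^ (i j) x ^ i y ^ j`, where `i` and `j` run from `0` to `n - 1`. It is a
bicharacter in commuting `x` and `y` with `x ^ n = y ^ n = 1`. -/
def bichar (p : 𝕜) (n : ℕ) (x y : B) : B := ∑ i ∈ Finset.range n, x ^ i * eigenProj p n y i

variable {p : 𝕜} {n : ℕ} {x x' y z : B}

lemma bichar_comm (p : 𝕜) (n : ℕ) (h : Commute x y) : bichar p n x y = bichar p n y x := by
  simp only [bichar, eigenProj, Finset.mul_sum, mul_smul_comm, Finset.smul_sum]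
  rw [Finset.sum_comm]
  refine Finset.sum_congr rfl fun i _ => Finset.sum_congr rfl fun j _ => ?_
  rw [mul_comm i j, (h.pow_pow j i).eq]

lemma map_bichar {B' : Type*} [Ring B'] [Algebra 𝕜 B'] (f : B →ₐ[𝕜] B') (p : 𝕜) (n : ℕ)
    (x y : B) : f (bichar p n x y) = bichar p n (f x) (f y) := by
  simp [bichar, eigenProj]

lemma commute_eigenProj (p : 𝕜) (n : ℕ) (h : Commute z y) (i : ℕ) :
    Commute z (eigenProj p n y i) :=
  (Commute.sum_right _ _ _ fun _ _ => (h.pow_right _).smul_right _).smul_right _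

lemma commute_bichar (p : 𝕜) (n : ℕ) (hx : Commute z x) (hy : Commute z y) :
    Commute z (bichar p n x y) :=
  Commute.sum_right _ _ _ fun i _ => (hx.pow_right i).mul_right (commute_eigenProj p n hy i)

/-- The image of `eigenProj p n y i` lies in the `p ^ (-i)`-eigenspace of `y`. -/
lemma smul_mul_eigenProj (hp : p ^ n = 1) (hy : y ^ n = 1) (i : ℕ) :
    p ^ i • (y * eigenProj p n y i) = eigenProj p n y i := by
  have e1 : ∑ j ∈ Finset.range n, p ^ (i * (j + 1)) • y ^ (j + 1) =
      ∑ j ∈ Finset.range n, p ^ (i * j) • y ^ j := by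
    have h1 := Finset.sum_range_succ (fun j => p ^ (i * j) • y ^ j) n
    rw [Finset.sum_range_succ'] at h1
    simpa [hy, mul_comm i n, pow_mul, hp] using h1
  rw [eigenProj, mul_smul_comm, smul_comm, Finset.mul_sum, Finset.smul_sum, ← e1]
  refine congrArg _ (Finset.sum_congr rfl fun j _ => ?_)
  rw [mul_smul_comm, smul_smul, ← pow_succ', ← pow_add, mul_add, mul_one, add_comm]

lemma eigenProj_mul_self (hn : (n : 𝕜) ≠ 0) (hp : p ^ n = 1) (hy : y ^ n = 1) (i : ℕ) :
    eigenProj p n y i * eigenProj p n y i = eigenProj p n y i := by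
  have e1 : ∀ j : ℕ, p ^ (i * j) • (y ^ j * eigenProj p n y i) = eigenProj p n y i := by
    intro j
    induction j with
    | zero => simp
    | succ j ih =>
      rw [mul_add, mul_one, pow_add, mul_smul, pow_succ, mul_assoc, ← mul_smul_comm,
        smul_mul_eigenProj hp hy, ih]
  nth_rw 1 [eigenProj]
  rw [smul_mul_assoc, Finset.sum_mul]
  simp only [smul_mul_assoc, e1, Finset.sum_const, Finset.card_range]
  rw [← Nat.cast_smul_eq_nsmul 𝕜, smul_smul, inv_mul_cancel₀ hn, one_smul]

lemma eigenProj_mul_of_ne (hp : IsPrimitiveRoot p n) (hy : y ^ n = 1) {i j : ℕ}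
    (hi : i < n) (hj : j < n) (hij : i ≠ j) : eigenProj p n y i * eigenProj p n y j = 0 := by
  have h1 : p ^ i • (y * (eigenProj p n y i * eigenProj p n y j)) =
      eigenProj p n y i * eigenProj p n y j := by
    rw [← mul_assoc, ← smul_mul_assoc, smul_mul_eigenProj hp.pow_eq_one hy]
  have h2 : p ^ j • (y * (eigenProj p n y i * eigenProj p n y j)) =
      eigenProj p n y i * eigenProj p n y j := by
    rw [← mul_assoc, (commute_eigenProj p n (Commute.refl y) i).eq, mul_assoc, ← mul_smul_comm,
      smul_mul_eigenProj hp.pow_eq_one hy]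
  have h3 : (p ^ i - p ^ j) • (y * (eigenProj p n y i * eigenProj p n y j)) = 0 := by
    rw [sub_smul, h1, h2, sub_self]
  have h4 := (smul_eq_zero.mp h3).resolve_left
    (sub_ne_zero.mpr fun h => hij (hp.pow_inj hi hj h))
  rw [← h1, h4, smul_zero]

lemma sum_eigenProj (hn : (n : 𝕜) ≠ 0) (hp : IsPrimitiveRoot p n) (y : B) :
    ∑ i ∈ Finset.range n, eigenProj p n y i = 1 := by
  have h0 : n ≠ 0 := fun h => hn (by simp [h])
  simp only [eigenProj, ← Finset.smul_sum]
  rw [Finset.sum_comm, Finset.sum_eq_single 0]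
  · simp [← Nat.cast_smul_eq_nsmul 𝕜, smul_smul, inv_mul_cancel₀ hn]
  · intro j hj hj0
    have h1 := mul_geom_sum (p ^ j) n
    rw [← pow_mul, mul_comm j n, pow_mul, hp.pow_eq_one, one_pow, sub_self] at h1
    have h2 := (mul_eq_zero.mp h1).resolve_left
      (sub_ne_zero.mpr (hp.pow_ne_one_of_pos_of_lt hj0 (Finset.mem_range.mp hj)))
    rw [← Finset.sum_smul]
    simp only [mul_comm _ j, pow_mul]
    rw [h2, zero_smul]
  · intro h
    exact absurd (Finset.mem_range.mpr (Nat.pos_of_ne_zero h0)) h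

lemma bichar_one_left (hn : (n : 𝕜) ≠ 0) (hp : IsPrimitiveRoot p n) (y : B) :
    bichar p n 1 y = 1 := by
  simp [bichar, sum_eigenProj hn hp]

/-- Bimultiplicativity holds because `eigenProj p n y` is a complete family of orthogonal
idempotents. -/
lemma bichar_mul_left (hn : (n : 𝕜) ≠ 0) (hp : IsPrimitiveRoot p n) (hy : y ^ n = 1)
    (hx : Commute x x') (hxy : Commute x' y) :
    bichar p n x y * bichar p n x' y = bichar p n (x * x') y := by
  have h0 : n ≠ 0 := fun h => hn (by simp [h])
  simp only [bichar, Finset.sum_mul_sum]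
  refine Finset.sum_congr rfl fun i hi => ?_
  have e1 : ∀ j, x ^ i * eigenProj p n y i * (x' ^ j * eigenProj p n y j) =
      x ^ i * x' ^ j * (eigenProj p n y i * eigenProj p n y j) := by
    intro j
    rw [mul_assoc, ← mul_assoc _ (x' ^ j), ← ((commute_eigenProj p n hxy i).pow_left j).eq]
    simp only [mul_assoc]
  rw [Finset.sum_eq_single i]
  · rw [e1, eigenProj_mul_self hn hp.pow_eq_one hy, hx.mul_pow]
  · intro j hj hji
    rw [e1, eigenProj_mul_of_ne hp hy (Finset.mem_range.mp hi) (Finset.mem_range.mp hj)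
      hji.symm, mul_zero]
  · intro h
    exact absurd hi h

lemma isUnit_bichar (hn : (n : 𝕜) ≠ 0) (hp : IsPrimitiveRoot p n) (hy : y ^ n = 1)
    (hxx' : x * x' = 1) (hx'x : x' * x = 1) (hxy : Commute x y) (hxy' : Commute x' y) :
    IsUnit (bichar p n x y) := by
  have hc : Commute x x' := hxx'.trans hx'x.symm
  refine ⟨⟨bichar p n x y, bichar p n x' y, ?_, ?_⟩, rfl⟩
  · rw [bichar_mul_left hn hp hy hc hxy', hxx', bichar_one_left hn hp]
  · rw [bichar_mul_left hn hp hy hc.symm hxy, hx'x, bichar_one_left hn hp]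

/-- Moving across the bicharacter an element `z` that has weight `p` with respect to `x` and
commutes with `y` multiplies it by `y`. -/
lemma bichar_mul_of_mul_eq_smul (hp : p ^ n = 1) (hy : y ^ n = 1)
    (hzx : z * x = p • (x * z)) (hzy : Commute z y) (hxy : Commute x y) :
    bichar p n x y * z = z * y * bichar p n x y := by
  simp only [bichar, Finset.sum_mul, Finset.mul_sum]
  refine Finset.sum_congr rfl fun i _ => ?_
  rw [mul_assoc, ← (commute_eigenProj p n hzy i).eq, mul_assoc z y, ← mul_assoc y,
    (hxy.pow_left i).eq.symm, mul_assoc (x ^ i) y, ← mul_assoc z, mul_pow_of_mul_eq_smul hzx,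
    smul_mul_assoc, mul_assoc (x ^ i) z, ← mul_smul_comm, ← mul_smul_comm,
    smul_mul_eigenProj hp hy]

lemma mul_bichar_of_mul_eq_smul (hp : p ^ n = 1) (hy : y ^ n = 1)
    (hxz : x * z = p • (z * x)) (hzy : Commute z y) :
    z * bichar p n x y = bichar p n x y * (z * y) := by
  simp only [bichar, Finset.sum_mul, Finset.mul_sum]
  refine Finset.sum_congr rfl fun i _ => ?_
  rw [mul_assoc, ← mul_assoc _ z, ← (commute_eigenProj p n hzy i).eq, mul_assoc z,
    ← (commute_eigenProj p n (Commute.refl y) i).eq, ← mul_assoc (x ^ i) z,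
    pow_mul_of_mul_eq_smul hxz, smul_mul_assoc, ← mul_smul_comm, smul_mul_eigenProj hp hy,
    mul_assoc]

end Cartan

/-! ### Von Neumann regular antipodes from generators -/

section VonNeumann

variable {A : Type*} [Ring A] [Bialgebra ℂ A] {T : A →ₗ[ℂ] A}

/-- For an antimorphism `T`, `id ⋆ T` is multiplicative where its second value is central, since
`(id ⋆ T)(x y) = x₁ (id ⋆ T)(y) T(x₂)`. -/
lemma convolution_id_antihom_mul (hT : ∀ x y, T (x * y) = T y * T x) (x : A) {y : A}
    (hy : convolution LinearMap.id T y ∈ Subalgebra.center ℂ A) :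
    convolution LinearMap.id T (x * y) =
      convolution LinearMap.id T x * convolution LinearMap.id T y := by
  have h1 : ∀ (a b : A) (s : A ⊗[ℂ] A),
      LinearMap.mul' ℂ A (TensorProduct.map LinearMap.id T ((a ⊗ₜ b) * s)) =
        a * LinearMap.mul' ℂ A (TensorProduct.map LinearMap.id T s) * T b := by
    intro a b s
    induction s with
    | zero => simp
    | tmul c d => simp [hT, mul_assoc]
    | add s t hs ht => simp only [mul_add, map_add, hs, ht, add_mul]
  have h2 : ∀ t : A ⊗[ℂ] A,
      LinearMap.mul' ℂ A (TensorProduct.map LinearMap.id T (t * Coalgebra.comul y)) =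
        LinearMap.mul' ℂ A (TensorProduct.map LinearMap.id T t) *
          convolution LinearMap.id T y := by
    intro t
    induction t with
    | zero => simp
    | tmul a b =>
      rw [h1]
      change a * convolution LinearMap.id T y * T b = _
      rw [mul_assoc, ← Subalgebra.mem_center_iff.mp hy, ← mul_assoc]
      simp
    | add s t hs ht => simp only [add_mul, map_add, hs, ht]
  simpa [convolution] using h2 (Coalgebra.comul x)

/-- For an antimorphism `T`, `T ⋆ id` is multiplicative where its first value is central, since
`(T ⋆ id)(x y) = T(y₁) (T ⋆ id)(x) y₂`. -/
lemma convolution_antihom_id_mul (hT : ∀ x y, T (x * y) = T y * T x) {x : A} (y : A)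
    (hx : convolution T LinearMap.id x ∈ Subalgebra.center ℂ A) :
    convolution T LinearMap.id (x * y) =
      convolution T LinearMap.id x * convolution T LinearMap.id y := by
  have h1 : ∀ (a b : A) (s : A ⊗[ℂ] A),
      LinearMap.mul' ℂ A (TensorProduct.map T LinearMap.id (s * (a ⊗ₜ b))) =
        T a * LinearMap.mul' ℂ A (TensorProduct.map T LinearMap.id s) * b := by
    intro a b s
    induction s with
    | zero => simp
    | tmul c d => simp [hT, mul_assoc]
    | add s t hs ht => simp only [mul_add, map_add, hs, ht, add_mul]
  have h2 : ∀ t : A ⊗[ℂ] A,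
      LinearMap.mul' ℂ A (TensorProduct.map T LinearMap.id (Coalgebra.comul x * t)) =
        convolution T LinearMap.id x *
          LinearMap.mul' ℂ A (TensorProduct.map T LinearMap.id t) := by
    intro t
    induction t with
    | zero => simp
    | tmul a b =>
      rw [h1]
      change T a * convolution T LinearMap.id x * b = _
      rw [Subalgebra.mem_center_iff.mp hx, mul_assoc]
      simp
    | add s t hs ht => simp only [mul_add, map_add, hs, ht]
  simpa [convolution] using h2 (Coalgebra.comul y)

lemma convolution_one (f g : A →ₗ[ℂ] A) : convolution f g 1 = f 1 * g 1 := by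
  simp [convolution, Algebra.TensorProduct.one_def]

/-- An antimorphism `T` is a von Neumann regular antipode as soon as, on a set of algebra
generators, `id ⋆ T` and `T ⋆ id` are central and the two regularity identities hold. Centrality
makes `id ⋆ T` and `T ⋆ id` algebra morphisms; then `id ⋆ T ⋆ id` is a morphism and `T ⋆ id ⋆ T`
an antimorphism of algebras, so that they are determined by their values on the generators. -/
theorem IsVonNeumannAntipode.of_adjoin_eq_top (h1 : T 1 = 1)
    (hT : ∀ x y, T (x * y) = T y * T x) {s : Set A} (hs : Algebra.adjoin ℂ s = ⊤)
    (hc : ∀ x ∈ s, convolution LinearMap.id T x ∈ Subalgebra.center ℂ A)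
    (hc' : ∀ x ∈ s, convolution T LinearMap.id x ∈ Subalgebra.center ℂ A)
    (hid : ∀ x ∈ s, convolution (convolution LinearMap.id T) LinearMap.id x = x)
    (hconv : ∀ x ∈ s, convolution (convolution T LinearMap.id) T x = T x) :
    IsVonNeumannAntipode T := by
  have e1 : convolution LinearMap.id T 1 = 1 := by simp [convolution_one, h1]
  have e1' : convolution T LinearMap.id 1 = 1 := by simp [convolution_one, h1]
  have hmem : ∀ x, x ∈ Algebra.adjoin ℂ s := fun x => hs ▸ Algebra.mem_top
  have hcent : ∀ x, convolution LinearMap.id T x ∈ Subalgebra.center ℂ A := by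
    intro x
    induction hmem x using Algebra.adjoin_induction with
    | mem x hx => exact hc x hx
    | algebraMap r =>
      rw [Algebra.algebraMap_eq_smul_one, map_smul, e1]
      exact Subalgebra.smul_mem _ (one_mem _) _
    | add x y _ _ hx hy => rw [map_add]; exact add_mem hx hy
    | mul x y _ _ hx hy => rw [convolution_id_antihom_mul hT x hy]; exact mul_mem hx hy
  have hcent' : ∀ x, convolution T LinearMap.id x ∈ Subalgebra.center ℂ A := by
    intro x
    induction hmem x using Algebra.adjoin_induction with
    | mem x hx => exact hc' x hx
    | algebraMap r =>
      rw [Algebra.algebraMap_eq_smul_one, map_smul, e1']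
      exact Subalgebra.smul_mem _ (one_mem _) _
    | add x y _ _ hx hy => rw [map_add]; exact add_mem hx hy
    | mul x y _ _ hx hy => rw [convolution_antihom_id_mul hT y hx]; exact mul_mem hx hy
  let e : A →ₐ[ℂ] A := AlgHom.ofLinearMap (convolution LinearMap.id T) e1
    fun x y => convolution_id_antihom_mul hT x (hcent y)
  let eOp : A →ₐ[ℂ] Aᵐᵒᵖ := AlgHom.ofLinearMap
    ((MulOpposite.opLinearEquiv ℂ).toLinearMap ∘ₗ convolution T LinearMap.id) (by simp [e1'])
    fun x y => by
      simp only [LinearMap.comp_apply, LinearEquiv.coe_coe, MulOpposite.coe_opLinearEquiv]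
      rw [convolution_antihom_id_mul hT y (hcent' x), ← Subalgebra.mem_center_iff.mp (hcent' x),
        MulOpposite.op_mul]
  let TOp : A →ₐ[ℂ] Aᵐᵒᵖ := AlgHom.ofLinearMap
    ((MulOpposite.opLinearEquiv ℂ).toLinearMap ∘ₗ T) (by simp [h1]) fun x y => by simp [hT]
  have he : ∀ x y, Commute (e x) (AlgHom.id ℂ A y) := fun x y =>
    (Subalgebra.mem_center_iff.mp (hcent x) y).symm
  have heOp : ∀ x y, Commute (eOp x) (TOp y) := fun x y =>
    congrArg MulOpposite.op (Subalgebra.mem_center_iff.mp (hcent' x) (T y))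
  let f : A →ₐ[ℂ] A :=
    (Algebra.TensorProduct.lift e (AlgHom.id ℂ A) he).comp (Bialgebra.comulAlgHom ℂ A)
  let g : A →ₐ[ℂ] Aᵐᵒᵖ :=
    (Algebra.TensorProduct.lift eOp TOp heOp).comp (Bialgebra.comulAlgHom ℂ A)
  have hf : ∀ x, f x = convolution (convolution LinearMap.id T) LinearMap.id x := by
    intro x
    change Algebra.TensorProduct.lift e (AlgHom.id ℂ A) he (Coalgebra.comul x) =
      LinearMap.mul' ℂ A (TensorProduct.map _ _ (Coalgebra.comul x))
    induction (Coalgebra.comul x : A ⊗[ℂ] A) with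
    | zero => simp
    | tmul a b => simp [e]
    | add s t hs ht => rw [map_add, map_add, map_add, hs, ht]
  have hg : ∀ x, (g x).unop = convolution (convolution T LinearMap.id) T x := by
    intro x
    change (Algebra.TensorProduct.lift eOp TOp heOp (Coalgebra.comul x)).unop =
      LinearMap.mul' ℂ A (TensorProduct.map _ _ (Coalgebra.comul x))
    induction (Coalgebra.comul x : A ⊗[ℂ] A) with
    | zero => simp
    | tmul a b =>
      simp only [Algebra.TensorProduct.lift_tmul, MulOpposite.unop_mul, TensorProduct.map_tmul,
        LinearMap.mul'_apply]
      exact Subalgebra.mem_center_iff.mp (hcent' a) (T b)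
    | add s t hs ht => rw [map_add, map_add, map_add, MulOpposite.unop_add, hs, ht]
  have hf' : f = AlgHom.id ℂ A :=
    AlgHom.ext_of_adjoin_eq_top hs fun x hx => (hf x).trans (hid x hx)
  have hg' : g = TOp := AlgHom.ext_of_adjoin_eq_top hs fun x hx =>
    MulOpposite.unop_injective ((hg x).trans (hconv x hx))
  refine ⟨h1, hT, LinearMap.ext fun x => ?_, LinearMap.ext fun x => ?_⟩
  · rw [← hf, hf']; rfl
  · rw [← hg, hg']; rfl

/-- Von Neumann regularity of an antipode descends along a surjective morphism of bialgebras. -/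
lemma IsVonNeumannAntipode.of_surjective {B : Type*} [Ring B] [Bialgebra ℂ B]
    (hT : IsVonNeumannAntipode T) {S : B →ₗ[ℂ] B} {f : A →ₐc[ℂ] B}
    (hf : Function.Surjective f) (hS : ∀ x, S (f x) = f (T x)) : IsVonNeumannAntipode S := by
  have hconv : ∀ {g h : A →ₗ[ℂ] A} {g' h' : B →ₗ[ℂ] B}, (∀ x, g' (f x) = f (g x)) →
      (∀ x, h' (f x) = f (h x)) → ∀ x, convolution g' h' (f x) = f (convolution g h x) := by
    intro g h g' h' hg hh x
    rw [convolution, LinearMap.comp_apply, LinearMap.comp_apply,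
      ← CoalgHomClass.map_comp_comul_apply, convolution, LinearMap.comp_apply, LinearMap.comp_apply]
    induction (Coalgebra.comul x : A ⊗[ℂ] A) with
    | zero => simp
    | tmul a b => simp [hg, hh]
    | add s t hs ht => simp only [map_add, hs, ht]
  have hid : ∀ x, (LinearMap.id : B →ₗ[ℂ] B) (f x) = f ((LinearMap.id : A →ₗ[ℂ] A) x) :=
    fun _ => rfl
  refine ⟨?_, fun x y => ?_, LinearMap.ext fun x => ?_, LinearMap.ext fun x => ?_⟩
  · rw [← _root_.map_one f, hS, hT.map_one]
  · obtain ⟨x, rfl⟩ := hf x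
    obtain ⟨y, rfl⟩ := hf y
    rw [← _root_.map_mul, hS, hT.map_mul, _root_.map_mul, hS, hS]
  · obtain ⟨x, rfl⟩ := hf x
    rw [hconv (hconv hid hS) hid, hT.id_conv]
    rfl
  · obtain ⟨x, rfl⟩ := hf x
    rw [hconv (hconv hS hid) hS, hT.conv_id, hS]

end VonNeumann

/-! ### The universal R-matrix of a small quantum group -/

section SmallQuantum

/-- The R-matrix in factorized form: the bicharacter of the group generated by `k` times the
truncated exponential of `(q - q⁻¹) E ⊗ F` to the base `q⁻²`. -/
def factorizedRMatrix {A : Type*} [Ring A] [Algebra ℂ A] (n : ℕ) (q : ℂ) (k E F : A) : A ⊗[ℂ] A :=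
  bichar (q ^ 2)⁻¹ n (k ⊗ₜ 1) (1 ⊗ₜ k) * gaussExp (q ^ 2)⁻¹ n ((q - q⁻¹) • (E ⊗ₜ F))

variable {A : Type*} [Ring A] [Bialgebra ℂ A]

/-- The elements `k`, `k' = k⁻¹`, `E`, `F` of a bialgebra satisfy the relations of the small
quantum group of `sl₂` at a root of unity `q` of order `n`. They need not generate. -/
structure IsSmallQuantumTriple (n : ℕ) (q : ℂ) (k k' E F : A) : Prop where
  k_k' : k * k' = 1
  k'_k : k' * k = 1
  k_pow : k ^ n = 1
  E_pow : E ^ n = 0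
  F_pow : F ^ n = 0
  E_k : E * k = (q ^ 2)⁻¹ • (k * E)
  k_F : k * F = (q ^ 2)⁻¹ • (F * k)
  E_F : E * F = F * E + (q - q⁻¹)⁻¹ • (k - k')
  comul_k : Coalgebra.comul (R := ℂ) k = k ⊗ₜ[ℂ] k
  comul_E : Coalgebra.comul (R := ℂ) E = 1 ⊗ₜ[ℂ] E + E ⊗ₜ[ℂ] k
  comul_F : Coalgebra.comul (R := ℂ) F = F ⊗ₜ[ℂ] 1 + k' ⊗ₜ[ℂ] F

namespace IsSmallQuantumTriple

variable {n : ℕ} {q : ℂ} {k k' E F : A}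

lemma k'_E (h : IsSmallQuantumTriple n q k k' E F) : k' * E = (q ^ 2)⁻¹ • (E * k') := by
  calc k' * E = k' * (E * k) * k' := by rw [mul_assoc, mul_assoc, h.k_k', mul_one]
    _ = _ := by rw [h.E_k, mul_smul_comm, ← mul_assoc, h.k'_k, one_mul, smul_mul_assoc]

lemma F_k' (h : IsSmallQuantumTriple n q k k' E F) : F * k' = (q ^ 2)⁻¹ • (k' * F) := by
  calc F * k' = k' * (k * F) * k' := by rw [← mul_assoc, h.k'_k, one_mul]
    _ = _ := by
      rw [h.k_F, mul_smul_comm, smul_mul_assoc, ← mul_assoc, mul_assoc, h.k_k', mul_one]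

lemma isUnit_factorizedRMatrix (h : IsSmallQuantumTriple n q k k' E F) (hn : n ≠ 0)
    (hp : IsPrimitiveRoot (q ^ 2)⁻¹ n) : IsUnit (factorizedRMatrix n q k E F) := by
  refine (isUnit_bichar (x' := k' ⊗ₜ 1) (Nat.cast_ne_zero.mpr hn) hp ?_ ?_ ?_ ?_ ?_).mul
    (isUnit_gaussExp _ hn ?_)
  · simp [Algebra.TensorProduct.tmul_pow, h.k_pow, Algebra.TensorProduct.one_def]
  · simp [h.k_k', Algebra.TensorProduct.one_def]
  · simp [h.k'_k, Algebra.TensorProduct.one_def]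
  · simp [commute_iff_eq]
  · simp [commute_iff_eq]
  · simp [smul_pow, Algebra.TensorProduct.tmul_pow, h.E_pow]

/-- Moving the bicharacter across `Δᶜᵒᵖ(E) = E ⊗ 1 + k ⊗ E` turns it into `E ⊗ k' + 1 ⊗ E`. The
commutator of `1 ⊗ E` and `E ⊗ F` is proportional to `E ⊗ k - E ⊗ k'`, so that the truncated
exponential intertwines this element with `Δ(E)`. -/
lemma factorizedRMatrix_mul_comul_E (h : IsSmallQuantumTriple n q k k' E F) (hn : 1 < n)
    (hp : IsPrimitiveRoot (q ^ 2)⁻¹ n) (hl : q - q⁻¹ ≠ 0) :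
    TensorProduct.comm ℂ A A (Coalgebra.comul E) * factorizedRMatrix n q k E F =
      factorizedRMatrix n q k E F * Coalgebra.comul E := by
  have hx : (k ⊗ₜ[ℂ] (1 : A)) ^ n = 1 := by
    simp [Algebra.TensorProduct.tmul_pow, h.k_pow, Algebra.TensorProduct.one_def]
  have hy : ((1 : A) ⊗ₜ[ℂ] k) ^ n = 1 := by
    simp [Algebra.TensorProduct.tmul_pow, h.k_pow, Algebra.TensorProduct.one_def]
  have hxy : Commute (k ⊗ₜ[ℂ] (1 : A)) (1 ⊗ₜ[ℂ] k) := by simp [commute_iff_eq]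
  have c1 : (k ⊗ₜ[ℂ] E) * bichar (q ^ 2)⁻¹ n (k ⊗ₜ 1) (1 ⊗ₜ k) =
      bichar (q ^ 2)⁻¹ n (k ⊗ₜ 1) (1 ⊗ₜ k) * (1 ⊗ₜ E) := by
    rw [bichar_comm _ _ hxy, bichar_mul_of_mul_eq_smul (z := (1 : A) ⊗ₜ[ℂ] E) hp.pow_eq_one hx]
    · simp
    · simp [h.E_k]
    · simp [commute_iff_eq]
    · exact hxy.symm
  have c2 : (E ⊗ₜ[ℂ] (1 : A)) * bichar (q ^ 2)⁻¹ n (k ⊗ₜ 1) (1 ⊗ₜ k) =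
      bichar (q ^ 2)⁻¹ n (k ⊗ₜ 1) (1 ⊗ₜ k) * (E ⊗ₜ k') := by
    rw [bichar_mul_of_mul_eq_smul (z := E ⊗ₜ[ℂ] k') hp.pow_eq_one hy]
    · simp [h.k'_k]
    · simp [h.E_k, TensorProduct.smul_tmul']
    · simp [commute_iff_eq, h.k_k', h.k'_k]
    · exact hxy
  have key := gaussExp_intertwines (n := n) (a := (1 : A) ⊗ₜ[ℂ] E) (u := E ⊗ₜ k)
    (v := E ⊗ₜ k') (X := (q - q⁻¹) • (E ⊗ₜ F)) hp hn
    (by simp [h.E_F, TensorProduct.tmul_add, TensorProduct.tmul_sub, smul_smul, hl])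
    (by simp [h.k_F, smul_smul, mul_comm])
    (by simp [h.F_k', smul_smul, mul_comm])
    (by
      simp only [smul_pow, Algebra.TensorProduct.tmul_pow, smul_mul_assoc,
        Algebra.TensorProduct.tmul_mul_tmul, ← pow_succ, Nat.sub_add_cancel hn.le, h.E_pow,
        TensorProduct.zero_tmul, smul_zero])
    (by
      simp only [smul_pow, Algebra.TensorProduct.tmul_pow, mul_smul_comm,
        Algebra.TensorProduct.tmul_mul_tmul, ← pow_succ', Nat.sub_add_cancel hn.le, h.E_pow,
        TensorProduct.zero_tmul, smul_zero])
  rw [h.comul_E, map_add, TensorProduct.comm_tmul, TensorProduct.comm_tmul, factorizedRMatrix,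
    mul_assoc, ← key, ← mul_assoc, ← mul_assoc, add_mul, mul_add, c1, c2, add_comm]

/-- The argument for `E`, with `F ⊗ 1`, `k' ⊗ F` and `k ⊗ F` in place of `1 ⊗ E`, `E ⊗ k` and
`E ⊗ k'`. -/
lemma factorizedRMatrix_mul_comul_F (h : IsSmallQuantumTriple n q k k' E F) (hn : 1 < n)
    (hp : IsPrimitiveRoot (q ^ 2)⁻¹ n) (hl : q - q⁻¹ ≠ 0) :
    TensorProduct.comm ℂ A A (Coalgebra.comul F) * factorizedRMatrix n q k E F =
      factorizedRMatrix n q k E F * Coalgebra.comul F := by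
  have hx : (k ⊗ₜ[ℂ] (1 : A)) ^ n = 1 := by
    simp [Algebra.TensorProduct.tmul_pow, h.k_pow, Algebra.TensorProduct.one_def]
  have hy : ((1 : A) ⊗ₜ[ℂ] k) ^ n = 1 := by
    simp [Algebra.TensorProduct.tmul_pow, h.k_pow, Algebra.TensorProduct.one_def]
  have hxy : Commute (k ⊗ₜ[ℂ] (1 : A)) (1 ⊗ₜ[ℂ] k) := by simp [commute_iff_eq]
  have c1 : ((1 : A) ⊗ₜ[ℂ] F) * bichar (q ^ 2)⁻¹ n (k ⊗ₜ 1) (1 ⊗ₜ k) =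
      bichar (q ^ 2)⁻¹ n (k ⊗ₜ 1) (1 ⊗ₜ k) * (k ⊗ₜ F) := by
    rw [bichar_comm _ _ hxy, mul_bichar_of_mul_eq_smul (z := (1 : A) ⊗ₜ[ℂ] F) hp.pow_eq_one hx]
    · simp
    · simp [h.k_F]
    · simp [commute_iff_eq]
  have c2 : (F ⊗ₜ[ℂ] k') * bichar (q ^ 2)⁻¹ n (k ⊗ₜ 1) (1 ⊗ₜ k) =
      bichar (q ^ 2)⁻¹ n (k ⊗ₜ 1) (1 ⊗ₜ k) * (F ⊗ₜ 1) := by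
    rw [mul_bichar_of_mul_eq_smul (z := F ⊗ₜ[ℂ] k') hp.pow_eq_one hy]
    · simp [h.k'_k]
    · simp [h.k_F, TensorProduct.smul_tmul']
    · simp [commute_iff_eq, h.k_k', h.k'_k]
  have key := gaussExp_intertwines (n := n) (a := F ⊗ₜ[ℂ] (1 : A)) (u := k' ⊗ₜ F)
    (v := k ⊗ₜ F) (X := (q - q⁻¹) • (E ⊗ₜ F)) hp hn
    (by
      simp only [mul_smul_comm, smul_mul_assoc, Algebra.TensorProduct.tmul_mul_tmul, one_mul,
        mul_one, h.E_F, TensorProduct.add_tmul, TensorProduct.sub_tmul,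
        ← TensorProduct.smul_tmul', smul_add, smul_smul, mul_inv_cancel₀ hl, one_smul]
      abel)
    (by simp [h.k'_E, TensorProduct.smul_tmul', smul_smul, mul_comm])
    (by simp [h.E_k, TensorProduct.smul_tmul', smul_smul, mul_comm])
    (by
      simp only [smul_pow, Algebra.TensorProduct.tmul_pow, smul_mul_assoc,
        Algebra.TensorProduct.tmul_mul_tmul, ← pow_succ, Nat.sub_add_cancel hn.le, h.F_pow,
        TensorProduct.tmul_zero, smul_zero])
    (by
      simp only [smul_pow, Algebra.TensorProduct.tmul_pow, mul_smul_comm,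
        Algebra.TensorProduct.tmul_mul_tmul, ← pow_succ', Nat.sub_add_cancel hn.le, h.F_pow,
        TensorProduct.tmul_zero, smul_zero])
  rw [h.comul_F, map_add, TensorProduct.comm_tmul, TensorProduct.comm_tmul, factorizedRMatrix,
    mul_assoc, ← key, ← mul_assoc, ← mul_assoc, add_mul, mul_add, c1, c2, add_comm]

/-- The conjugate of `E ⊗ 1 ⊗ F` by the bicharacter in the last two legs is `E ⊗ k ⊗ F`, which
`q⁻²`-commutes with `1 ⊗ E ⊗ F`. The sum of the two is the image of `E ⊗ F` under `Δ ⊗ id`, so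
that the addition theorem for the truncated exponential applies. -/
lemma comul_id_factorizedRMatrix (h : IsSmallQuantumTriple n q k k' E F) (hn : 1 < n)
    (hp : IsPrimitiveRoot (q ^ 2)⁻¹ n) :
    TensorProduct.assoc ℂ A A A
      (TensorProduct.map Coalgebra.comul LinearMap.id (factorizedRMatrix n q k E F)) =
    leg13 (factorizedRMatrix n q k E F) * leg23 (factorizedRMatrix n q k E F) := by
  let Φ : A ⊗[ℂ] A →ₐ[ℂ] A ⊗[ℂ] (A ⊗[ℂ] A) :=
    (Algebra.TensorProduct.assoc ℂ ℂ ℂ A A A).toAlgHom.comp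
      (Algebra.TensorProduct.map (Bialgebra.comulAlgHom ℂ A) (AlgHom.id ℂ A))
  have hΦ : ∀ a b : A, Φ (a ⊗ₜ b) = TensorProduct.assoc ℂ A A A (Coalgebra.comul a ⊗ₜ b) :=
    fun _ _ => rfl
  have hx : Φ (k ⊗ₜ 1) = (k ⊗ₜ (1 ⊗ₜ 1)) * (1 ⊗ₜ (k ⊗ₜ 1)) := by simp [hΦ, h.comul_k]
  have hy : Φ (1 ⊗ₜ k) = 1 ⊗ₜ (1 ⊗ₜ k) := by simp [hΦ, Algebra.TensorProduct.one_def]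
  have hX : Φ (E ⊗ₜ F) = 1 ⊗ₜ (E ⊗ₜ F) + E ⊗ₜ (k ⊗ₜ F) := by
    simp [hΦ, h.comul_E, TensorProduct.add_tmul]
  have hyn : ((1 : A) ⊗ₜ[ℂ] ((1 : A) ⊗ₜ[ℂ] k)) ^ n = 1 := by
    simp [Algebra.TensorProduct.tmul_pow, h.k_pow, Algebra.TensorProduct.one_def]
  have hx'n : ((1 : A) ⊗ₜ[ℂ] (k ⊗ₜ[ℂ] (1 : A))) ^ n = 1 := by
    simp [Algebra.TensorProduct.tmul_pow, h.k_pow, Algebra.TensorProduct.one_def]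
  have hx'y : Commute ((1 : A) ⊗ₜ[ℂ] (k ⊗ₜ[ℂ] (1 : A))) (1 ⊗ₜ[ℂ] (1 ⊗ₜ[ℂ] k)) := by
    simp [commute_iff_eq]
  have hC := bichar_mul_left (x := k ⊗ₜ[ℂ] ((1 : A) ⊗ₜ[ℂ] (1 : A)))
    (Nat.cast_ne_zero.mpr (by omega : n ≠ 0)) hp hyn (by simp [commute_iff_eq]) hx'y
  have hconj : SemiconjBy
      (bichar (q ^ 2)⁻¹ n ((1 : A) ⊗ₜ[ℂ] (k ⊗ₜ[ℂ] (1 : A))) (1 ⊗ₜ[ℂ] (1 ⊗ₜ[ℂ] k)))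
      ((q - q⁻¹) • (E ⊗ₜ[ℂ] (k ⊗ₜ[ℂ] F))) ((q - q⁻¹) • (E ⊗ₜ[ℂ] (1 ⊗ₜ[ℂ] F))) := by
    rw [SemiconjBy, mul_smul_comm, smul_mul_assoc, bichar_comm _ _ hx'y,
      mul_bichar_of_mul_eq_smul (z := E ⊗ₜ[ℂ] ((1 : A) ⊗ₜ[ℂ] F)) hp.pow_eq_one hx'n]
    · simp
    · simp [h.k_F]
    · simp [commute_iff_eq]
  have hadd := gaussExp_add hp hn (X := (q - q⁻¹) • ((1 : A) ⊗ₜ[ℂ] (E ⊗ₜ[ℂ] F)))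
    (Y := (q - q⁻¹) • (E ⊗ₜ[ℂ] (k ⊗ₜ[ℂ] F)))
    (by
      simp only [mul_smul_comm, smul_mul_assoc, Algebra.TensorProduct.tmul_mul_tmul, one_mul,
        mul_one, h.E_k, ← TensorProduct.smul_tmul', TensorProduct.tmul_smul, smul_smul, mul_comm]
      rw [mul_assoc (q - q⁻¹)])
    (fun i j hij => by
      simp only [smul_pow, Algebra.TensorProduct.tmul_pow, smul_mul_smul_comm,
        Algebra.TensorProduct.tmul_mul_tmul, ← pow_add, pow_eq_zero_of_le hij h.F_pow,
        TensorProduct.tmul_zero, smul_zero])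
  change Φ (factorizedRMatrix n q k E F) = _
  simp only [factorizedRMatrix, map_mul, map_bichar, map_gaussExp, map_smul, hx, hy, hX, leg13,
    leg23, Algebra.TensorProduct.map_tmul, AlgHom.id_apply, map_one,
    Algebra.TensorProduct.includeRight_apply]
  rw [smul_add, hadd, ← hC, Algebra.TensorProduct.one_def, mul_assoc, mul_assoc]
  congr 1
  rw [← mul_assoc, ← mul_assoc, (gaussExp_semiconj _ n hconj).eq]

/-- The conjugate of `E ⊗ 1 ⊗ F` by the bicharacter in the first two legs is `E ⊗ k' ⊗ F`, which
`q⁻²`-commutes with `E ⊗ F ⊗ 1`. -/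
lemma id_comul_factorizedRMatrix (h : IsSmallQuantumTriple n q k k' E F) (hn : 1 < n)
    (hp : IsPrimitiveRoot (q ^ 2)⁻¹ n) :
    TensorProduct.map LinearMap.id Coalgebra.comul (factorizedRMatrix n q k E F) =
    leg13 (factorizedRMatrix n q k E F) * leg12 (factorizedRMatrix n q k E F) := by
  let Ψ : A ⊗[ℂ] A →ₐ[ℂ] A ⊗[ℂ] (A ⊗[ℂ] A) :=
    Algebra.TensorProduct.map (AlgHom.id ℂ A) (Bialgebra.comulAlgHom ℂ A)
  have hΨ : ∀ a b : A, Ψ (a ⊗ₜ b) = a ⊗ₜ Coalgebra.comul b := fun _ _ => rfl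
  have hx : Ψ (k ⊗ₜ 1) = k ⊗ₜ (1 ⊗ₜ 1) := by simp [hΨ, Algebra.TensorProduct.one_def]
  have hy : Ψ (1 ⊗ₜ k) = (1 ⊗ₜ (1 ⊗ₜ k)) * (1 ⊗ₜ (k ⊗ₜ 1)) := by simp [hΨ, h.comul_k]
  have hX : Ψ (E ⊗ₜ F) = E ⊗ₜ (F ⊗ₜ 1) + E ⊗ₜ (k' ⊗ₜ F) := by
    simp [hΨ, h.comul_F, TensorProduct.tmul_add]
  have hxn : (k ⊗ₜ[ℂ] ((1 : A) ⊗ₜ[ℂ] (1 : A))) ^ n = 1 := by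
    simp [Algebra.TensorProduct.tmul_pow, h.k_pow, Algebra.TensorProduct.one_def]
  have hyn : ((1 : A) ⊗ₜ[ℂ] (k ⊗ₜ[ℂ] (1 : A))) ^ n = 1 := by
    simp [Algebra.TensorProduct.tmul_pow, h.k_pow, Algebra.TensorProduct.one_def]
  have c1 : Commute (k ⊗ₜ[ℂ] ((1 : A) ⊗ₜ[ℂ] (1 : A))) (1 ⊗ₜ[ℂ] (1 ⊗ₜ[ℂ] k)) := by
    simp [commute_iff_eq]
  have c2 : Commute (k ⊗ₜ[ℂ] ((1 : A) ⊗ₜ[ℂ] (1 : A))) (1 ⊗ₜ[ℂ] (k ⊗ₜ[ℂ] 1)) := by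
    simp [commute_iff_eq]
  have c3 : Commute ((1 : A) ⊗ₜ[ℂ] ((1 : A) ⊗ₜ[ℂ] k)) (1 ⊗ₜ[ℂ] (k ⊗ₜ[ℂ] 1)) := by
    simp [commute_iff_eq]
  have hC := bichar_mul_left (Nat.cast_ne_zero.mpr (by omega : n ≠ 0)) hp hxn c3 c2.symm
  rw [← bichar_comm _ _ c1, ← bichar_comm _ _ c2, ← bichar_comm _ _ (c1.mul_right c2)] at hC
  have hconj : SemiconjBy
      (bichar (q ^ 2)⁻¹ n (k ⊗ₜ[ℂ] ((1 : A) ⊗ₜ[ℂ] (1 : A))) (1 ⊗ₜ[ℂ] (k ⊗ₜ[ℂ] 1)))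
      ((q - q⁻¹) • (E ⊗ₜ[ℂ] (k' ⊗ₜ[ℂ] F))) ((q - q⁻¹) • (E ⊗ₜ[ℂ] (1 ⊗ₜ[ℂ] F))) := by
    rw [SemiconjBy, mul_smul_comm, smul_mul_assoc,
      bichar_mul_of_mul_eq_smul (z := E ⊗ₜ[ℂ] (k' ⊗ₜ[ℂ] F)) hp.pow_eq_one hyn]
    · simp [h.k'_k]
    · simp [h.E_k, TensorProduct.smul_tmul']
    · simp [commute_iff_eq, h.k_k', h.k'_k]
    · exact c2
  have hadd := gaussExp_add hp hn (X := (q - q⁻¹) • (E ⊗ₜ[ℂ] (F ⊗ₜ[ℂ] (1 : A))))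
    (Y := (q - q⁻¹) • (E ⊗ₜ[ℂ] (k' ⊗ₜ[ℂ] F)))
    (by
      simp only [mul_smul_comm, smul_mul_assoc, Algebra.TensorProduct.tmul_mul_tmul, one_mul,
        mul_one, h.F_k', ← TensorProduct.smul_tmul', TensorProduct.tmul_smul, smul_smul, mul_comm]
      rw [mul_assoc (q - q⁻¹)])
    (fun i j hij => by
      simp only [smul_pow, Algebra.TensorProduct.tmul_pow, smul_mul_smul_comm,
        Algebra.TensorProduct.tmul_mul_tmul, ← pow_add, pow_eq_zero_of_le hij h.E_pow,
        TensorProduct.zero_tmul, smul_zero])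
  change Ψ (factorizedRMatrix n q k E F) = _
  simp only [factorizedRMatrix, map_mul, map_bichar, map_gaussExp, map_smul, hx, hy, hX, leg13,
    leg12, Algebra.TensorProduct.map_tmul, AlgHom.id_apply, map_one,
    Algebra.TensorProduct.includeRight_apply, Algebra.TensorProduct.includeLeft_apply]
  rw [smul_add, hadd, ← hC, Algebra.TensorProduct.one_def, mul_assoc, mul_assoc]
  congr 1
  rw [← mul_assoc, ← mul_assoc, (gaussExp_semiconj _ n hconj).eq]

/-- If the bialgebra is generated by `E`, `F` and elements with symmetric comultiplication that
commute with both factors of the R-matrix, then the R-matrix is universal. -/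
theorem isUniversalRMatrix (h : IsSmallQuantumTriple n q k k' E F) (hn : 1 < n)
    (hp : IsPrimitiveRoot (q ^ 2)⁻¹ n) (hl : q - q⁻¹ ≠ 0) {s : Set A}
    (hs : Algebra.adjoin ℂ s = ⊤)
    (hgen : ∀ b ∈ s, b = E ∨ b = F ∨
      (TensorProduct.comm ℂ A A (Coalgebra.comul b) = Coalgebra.comul b ∧
        Commute (Coalgebra.comul b) (k ⊗ₜ[ℂ] (1 : A)) ∧
        Commute (Coalgebra.comul b) ((1 : A) ⊗ₜ[ℂ] k) ∧
        Commute (Coalgebra.comul b) (E ⊗ₜ[ℂ] F))) :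
    IsUniversalRMatrix (factorizedRMatrix n q k E F) := by
  refine ⟨?_, h.comul_id_factorizedRMatrix hn hp, h.id_comul_factorizedRMatrix hn hp⟩
  obtain ⟨r, hr⟩ := h.isUnit_factorizedRMatrix (by omega) hp
  let cop : A →ₐ[ℂ] A ⊗[ℂ] A :=
    (Algebra.TensorProduct.comm ℂ A A).toAlgHom.comp (Bialgebra.comulAlgHom ℂ A)
  have hcop : ∀ b, cop b = TensorProduct.comm ℂ A A (Coalgebra.comul b) := fun _ => rfl
  have key : ∀ b, cop b * factorizedRMatrix n q k E F =
      factorizedRMatrix n q k E F * Bialgebra.comulAlgHom ℂ A b := by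
    intro b
    have hb : b ∈ Algebra.adjoin ℂ s := hs ▸ Algebra.mem_top
    induction hb using Algebra.adjoin_induction with
    | mem x hx =>
      rw [hcop]
      rcases hgen x hx with rfl | rfl | ⟨h1, h2, h3, h4⟩
      · exact h.factorizedRMatrix_mul_comul_E hn hp hl
      · exact h.factorizedRMatrix_mul_comul_F hn hp hl
      · rw [h1]
        exact ((commute_bichar _ _ h2 h3).mul_right (commute_gaussExp _ _ (h4.smul_right _))).eq
    | algebraMap r =>
      rw [AlgHom.commutes, AlgHom.commutes, Algebra.commutes]
    | add x y _ _ hx hy => rw [map_add, map_add, add_mul, mul_add, hx, hy]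
    | mul x y _ _ hx hy => rw [map_mul, map_mul, mul_assoc, hy, ← mul_assoc, hx, mul_assoc]
  refine ⟨(r⁻¹ : (A ⊗[ℂ] A)ˣ), ?_, ?_, fun b => ?_⟩
  · rw [← hr, Units.mul_inv]
  · rw [← hr, Units.inv_mul]
  · rw [← hcop, ← Bialgebra.comulAlgHom_apply, ← key, mul_assoc, ← hr, Units.mul_inv, mul_one]

end IsSmallQuantumTriple

end SmallQuantum

/-! ### The algebra `U q` and its quotient -/

namespace U

variable {q : ℂ}

lemma comul_gen (g : Gen) : Coalgebra.comul (R := ℂ) (gen q g) = comulGen q g :=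
  lift_gen (comulGen q) comulGen_rel g

lemma counit_gen (g : Gen) : Coalgebra.counit (R := ℂ) (gen q g) = counitGen g :=
  lift_gen counitGen counitGen_rel g

lemma adjoin_range_gen : Algebra.adjoin ℂ (Set.range (gen q)) = ⊤ := by
  have h1 : Set.range (gen q) = proj q '' Set.range (FreeAlgebra.ι ℂ) := by
    rw [← Set.range_comp]; rfl
  rw [h1, ← AlgHom.map_adjoin, FreeAlgebra.adjoin_range_ι, Algebra.map_top,
    AlgHom.range_eq_top]
  exact RingQuot.mkAlgHom_surjective ℂ (Rel q)

lemma KL_mul_KLbar : ((K + L) * (Kbar + Lbar) : U q) = 1 := by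
  simp [add_mul, mul_add, K_Lbar, L_Kbar, unity]

lemma KLbar_mul_KL : ((Kbar + Lbar) * (K + L) : U q) = 1 := by
  simp [add_mul, mul_add, Kbar_L, Lbar_K, K_comm, L_comm, unity]

lemma KL_E : ((K + L) * E : U q) = q ^ 2 • (E * (K + L)) := by
  rw [add_mul, mul_add, K_E, L_E, smul_add]

lemma KL_F : ((K + L) * F : U q) = (q ^ 2)⁻¹ • (F * (K + L)) := by
  rw [add_mul, mul_add, K_F, L_F, smul_add]

lemma comul_KL : Coalgebra.comul (R := ℂ) (K + L : U q) = (K + L) ⊗ₜ[ℂ] (K + L) := by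
  rw [map_add, comul_gen, comul_gen]
  simp only [comulGen, TensorProduct.tmul_add, TensorProduct.add_tmul]
  abel

lemma cartanPow_eq_pow (i : ℕ) : cartanPow q i = (K + L) ^ i := by
  induction i with
  | zero => rw [cartanPow_zero, pow_zero]
  | succ i ih =>
    rw [pow_succ, ← ih]
    rcases eq_or_ne i 0 with rfl | hi
    · simp [cartanPow_zero, cartanPow_of_ne_zero]
    · obtain ⟨j, rfl⟩ := Nat.exists_eq_succ_of_ne_zero hi
      have h1 : (K ^ (j + 1) * L : U q) = 0 := by rw [pow_succ, mul_assoc, K_L, mul_zero]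
      have h2 : (L ^ (j + 1) * K : U q) = 0 := by rw [pow_succ, mul_assoc, L_K, mul_zero]
      rw [cartanPow_of_ne_zero q hi, cartanPow_of_ne_zero q (Nat.succ_ne_zero _), add_mul,
        mul_add, mul_add, Nat.succ_eq_add_one, h1, h2, ← pow_succ, ← pow_succ, add_zero, zero_add]

lemma KL_pow {n : ℕ} (hn : n ≠ 0) : ((K + L) ^ n : U q) = K ^ n + L ^ n := by
  rw [← cartanPow_eq_pow, cartanPow_of_ne_zero q hn]

lemma P_L : (K * Kbar * L : U q) = 0 := by rw [mul_assoc, Kbar_L, mul_zero]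
lemma P_Lbar : (K * Kbar * Lbar : U q) = 0 := by rw [mul_assoc, Kbar_Lbar, mul_zero]
lemma Q_K : (L * Lbar * K : U q) = 0 := by rw [mul_assoc, Lbar_K, mul_zero]
lemma Q_Kbar : (L * Lbar * Kbar : U q) = 0 := by rw [mul_assoc, Lbar_Kbar, mul_zero]

lemma commute_P_gen (hq : q ≠ 0) (g : Gen) : Commute (gen q g) (K * Kbar) := by
  have hq2 : q ^ 2 ≠ 0 := pow_ne_zero 2 hq
  cases g
  · exact K_P.trans P_K.symm
  · exact Kbar_K_Kbar.trans P_Kbar.symm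
  · exact L_P.trans P_L.symm
  · exact Lbar_P.trans P_Lbar.symm
  · rw [commute_iff_eq, mul_assoc, Kbar_E, mul_smul_comm, ← mul_assoc K, K_E, smul_mul_assoc,
      smul_smul, inv_mul_cancel₀ hq2, one_smul, mul_assoc]
  · rw [commute_iff_eq, mul_assoc, Kbar_F, mul_smul_comm, ← mul_assoc K, K_F, smul_mul_assoc,
      smul_smul, mul_inv_cancel₀ hq2, one_smul, mul_assoc]

lemma P_mem_center (hq : q ≠ 0) : (K * Kbar : U q) ∈ Subalgebra.center ℂ (U q) := by
  refine Subalgebra.mem_center_iff.mpr fun x => ?_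
  have hx : x ∈ Algebra.adjoin ℂ (Set.range (gen q)) := adjoin_range_gen ▸ Algebra.mem_top
  induction hx using Algebra.adjoin_induction with
  | mem x hx => obtain ⟨g, rfl⟩ := hx; exact commute_P_gen hq g
  | algebraMap r => exact Algebra.commutes _ _
  | add x y _ _ hx hy => rw [add_mul, mul_add, hx, hy]
  | mul x y _ _ hx hy => rw [mul_assoc, hy, ← mul_assoc, hx, mul_assoc]

lemma Q_mem_center (hq : q ≠ 0) : (L * Lbar : U q) ∈ Subalgebra.center ℂ (U q) := by
  have h : (L * Lbar : U q) = 1 - K * Kbar := by rw [← unity]; abel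
  rw [h]
  exact sub_mem (one_mem _) (P_mem_center hq)

lemma antipode_gen (g : Gen) : antipode q (gen q g) = (antipodeGen q g).unop := by
  simp [antipode]

lemma antipode_one : antipode q 1 = 1 := by simp [antipode]

lemma antipode_mul (x y : U q) : antipode q (x * y) = antipode q y * antipode q x := by
  simp [antipode]

/-- On generators `id ⋆ T` takes the values `P = K K̄`, `Q = L L̄` and `0`. -/
lemma convolution_id_antipode_gen (g : Gen) :
    convolution LinearMap.id (antipode q) (gen q g) = match g with
      | .K => K * Kbar | .Kbar => K * Kbar
      | .L => L * Lbar | .Lbar => L * Lbar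
      | .E => 0 | .F => 0 := by
  rw [convolution, LinearMap.comp_apply, LinearMap.comp_apply, comul_gen]
  cases g <;>
    simp only [comulGen, map_add, TensorProduct.map_tmul, LinearMap.mul'_apply,
      LinearMap.id_apply, antipode_gen, antipodeGen, MulOpposite.unop_op, antipode_one]
  · exact K_comm
  · simp [L_Kbar, K_Lbar]
  · simp [Lbar_K, Kbar_L, L_comm]
  · simp [mul_add]
  · rw [mul_neg, ← mul_assoc, KLbar_mul_KL, one_mul, mul_one, add_neg_cancel]

lemma convolution_antipode_id_gen (g : Gen) :
    convolution (antipode q) LinearMap.id (gen q g) = match g with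
      | .K => K * Kbar | .Kbar => K * Kbar
      | .L => L * Lbar | .Lbar => L * Lbar
      | .E => 0 | .F => 0 := by
  rw [convolution, LinearMap.comp_apply, LinearMap.comp_apply, comul_gen]
  cases g <;>
    simp only [comulGen, map_add, TensorProduct.map_tmul, LinearMap.mul'_apply,
      LinearMap.id_apply, antipode_gen, antipodeGen, MulOpposite.unop_op, antipode_one]
  · exact K_comm
  · simp [Lbar_K, Kbar_L, L_comm]
  · simp [L_Kbar, K_Lbar]
  · rw [neg_mul, mul_assoc, KLbar_mul_KL, one_mul, mul_one, add_neg_cancel]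
  · simp

/-- The antimorphism `T` of `U q` is a von Neumann regular antipode. -/
theorem isVonNeumannAntipode (hq : q ≠ 0) : IsVonNeumannAntipode (antipode q) := by
  have hid : convolution LinearMap.id (antipode q) 1 = 1 := by
    simp [convolution_one, antipode_one]
  have hid' : convolution (antipode q) LinearMap.id 1 = 1 := by
    simp [convolution_one, antipode_one]
  refine .of_adjoin_eq_top antipode_one antipode_mul adjoin_range_gen ?_ ?_ ?_ ?_
  · rintro _ ⟨g, rfl⟩
    rw [convolution_id_antipode_gen]
    cases g <;> first | exact P_mem_center hq | exact Q_mem_center hq | exact zero_mem _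
  · rintro _ ⟨g, rfl⟩
    rw [convolution_antipode_id_gen]
    cases g <;> first | exact P_mem_center hq | exact Q_mem_center hq | exact zero_mem _
  · rintro _ ⟨g, rfl⟩
    rw [convolution, LinearMap.comp_apply, LinearMap.comp_apply, comul_gen]
    cases g <;>
      simp only [comulGen, map_add, TensorProduct.map_tmul, LinearMap.mul'_apply,
        LinearMap.id_apply, convolution_id_antipode_gen, hid, P_K, P_Kbar, P_L, P_Lbar, Q_K,
        Q_Kbar, Q_L, Q_Lbar, unity, one_mul, zero_mul, add_zero, zero_add]
  · rintro _ ⟨g, rfl⟩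
    rw [convolution, LinearMap.comp_apply, LinearMap.comp_apply, comul_gen]
    cases g <;>
      simp only [comulGen, map_add, TensorProduct.map_tmul, LinearMap.mul'_apply, antipode_gen,
        antipodeGen, MulOpposite.unop_op, convolution_antipode_id_gen, hid', P_K, P_Kbar, P_L,
        P_Lbar, Q_K, Q_Kbar, Q_L, Q_Lbar, unity, one_mul, zero_mul, add_zero, zero_add]

end U

/-- An algebra morphism from `U q` vanishes on the ideal if the images of `K + L`, `E` and `F`
satisfy the relations of the quotient: in `U q` one has `(K + L) ^ n = K ^ n + L ^ n`. -/
lemma map_eq_zero_of_mem_ideal {q : ℂ} {n : ℕ} (hn : n ≠ 0) {B : Type*} [Ring B] [Algebra ℂ B]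
    (f : U q →ₐ[ℂ] B) (hk : f (U.K + U.L) ^ n = 1) (hE : f U.E ^ n = 0) (hF : f U.F ^ n = 0)
    {x : U q} (hx : x ∈ ideal n q) : f x = 0 := by
  have h1 : TwoSidedIdeal.span {U.K ^ n + U.L ^ n - 1, U.E ^ n, U.F ^ n} ≤ TwoSidedIdeal.ker f := by
    rw [TwoSidedIdeal.span_le]
    rintro y (rfl | rfl | rfl)
    · rw [SetLike.mem_coe, TwoSidedIdeal.mem_ker, ← U.KL_pow hn, map_sub, map_pow, hk, map_one,
        sub_self]
    · rw [SetLike.mem_coe, TwoSidedIdeal.mem_ker, map_pow, hE]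
    · rw [SetLike.mem_coe, TwoSidedIdeal.mem_ker, map_pow, hF]
  exact (TwoSidedIdeal.mem_ker f).mp (h1 (TwoSidedIdeal.mem_asIdeal.mp hx))

namespace UHat

variable {n : ℕ} {q : ℂ}

/-- The projection from `U q` to the quotient algebra. -/
abbrev mk (n : ℕ) (q : ℂ) : U q →ₐ[ℂ] UHat n q := Ideal.Quotient.mkₐ ℂ (ideal n q)

lemma mk_surjective : Function.Surjective (mk n q) := Ideal.Quotient.mk_surjective

lemma mk_eq_zero {x : U q} (hx : x ∈ TwoSidedIdeal.span
    ({U.K ^ n + U.L ^ n - 1, U.E ^ n, U.F ^ n} : Set (U q))) : mk n q x = 0 :=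
  Ideal.Quotient.eq_zero_iff_mem.mpr (TwoSidedIdeal.mem_asIdeal.mpr hx)

lemma E_pow : mk n q U.E ^ n = 0 := by
  rw [← map_pow]
  exact mk_eq_zero (TwoSidedIdeal.subset_span (by simp))

lemma F_pow : mk n q U.F ^ n = 0 := by
  rw [← map_pow]
  exact mk_eq_zero (TwoSidedIdeal.subset_span (by simp))

lemma KL_pow (hn : n ≠ 0) : mk n q (U.K + U.L) ^ n = 1 := by
  rw [← map_pow, U.KL_pow hn, ← sub_eq_zero, ← map_one (mk n q), ← map_sub]
  exact mk_eq_zero (TwoSidedIdeal.subset_span (by simp))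

lemma KL_mul_KLbar : mk n q (U.K + U.L) * mk n q (U.Kbar + U.Lbar) = 1 := by
  rw [← map_mul, U.KL_mul_KLbar, map_one]

lemma KLbar_mul_KL : mk n q (U.Kbar + U.Lbar) * mk n q (U.K + U.L) = 1 := by
  rw [← map_mul, U.KLbar_mul_KL, map_one]

lemma KLbar_pow (hn : n ≠ 0) : mk n q (U.Kbar + U.Lbar) ^ n = 1 := by
  have h1 : Commute (mk n q (U.Kbar + U.Lbar)) (mk n q (U.K + U.L)) :=
    KLbar_mul_KL.trans KL_mul_KLbar.symm
  have h2 := h1.mul_pow n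
  rwa [KLbar_mul_KL, KL_pow hn, one_pow, mul_one, eq_comm] at h2

lemma E_KL (hq : q ≠ 0) : mk n q U.E * mk n q (U.K + U.L) =
    (q ^ 2)⁻¹ • (mk n q (U.K + U.L) * mk n q U.E) := by
  rw [← map_mul, ← map_mul, U.KL_E, map_smul, smul_smul, inv_mul_cancel₀ (pow_ne_zero 2 hq),
    one_smul]

lemma KL_F : mk n q (U.K + U.L) * mk n q U.F =
    (q ^ 2)⁻¹ • (mk n q U.F * mk n q (U.K + U.L)) := by
  rw [← map_mul, ← map_mul, U.KL_F, map_smul]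

lemma KLbar_E : mk n q (U.Kbar + U.Lbar) * mk n q U.E =
    (q ^ 2)⁻¹ • (mk n q U.E * mk n q (U.Kbar + U.Lbar)) := by
  rw [← map_mul, ← map_mul, ← map_smul, add_mul, U.Kbar_E, U.Lbar_E, mul_add, smul_add]

lemma F_KLbar (hq : q ≠ 0) : mk n q U.F * mk n q (U.Kbar + U.Lbar) =
    (q ^ 2)⁻¹ • (mk n q (U.Kbar + U.Lbar) * mk n q U.F) := by
  rw [← map_mul, ← map_mul, ← map_smul, add_mul, U.Kbar_F, U.Lbar_F, mul_add, smul_add,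
    smul_smul, smul_smul, inv_mul_cancel₀ (pow_ne_zero 2 hq), one_smul, one_smul]

lemma E_F : mk n q U.E * mk n q U.F = mk n q U.F * mk n q U.E +
    (q - q⁻¹)⁻¹ • (mk n q (U.K + U.L) - mk n q (U.Kbar + U.Lbar)) := by
  rw [← map_mul, U.E_F, map_add, map_mul, map_smul, map_sub]

lemma adjoin_range_gen :
    Algebra.adjoin ℂ (Set.range fun g => mk n q (U.gen q g)) = ⊤ := by
  have h1 : (Set.range fun g => mk n q (U.gen q g)) = mk n q '' Set.range (U.gen q) := by
    rw [← Set.range_comp]; rfl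
  rw [h1, ← AlgHom.map_adjoin, U.adjoin_range_gen, Algebra.map_top, AlgHom.range_eq_top]
  exact mk_surjective

/-- The ideal is a coideal: `Δ(E)` and `Δ(F)` are sums of two `q ^ (-2)`-commuting elements
with vanishing `n`-th powers, so their `n`-th powers vanish by the `p`-binomial formula. -/
lemma isCoideal (hn : 1 < n) (hq : q ≠ 0) (hp : IsPrimitiveRoot (q ^ 2)⁻¹ n) :
    ((ideal n q).restrictScalars ℂ).IsCoideal := by
  have hn0 : n ≠ 0 := by omega
  refine ⟨fun x hx => ?_, fun x hx => ?_⟩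
  · refine map_eq_zero_of_mem_ideal hn0 (Bialgebra.counitAlgHom ℂ (U q)) ?_ ?_ ?_ hx
    all_goals simp [U.counit_gen, U.counitGen, hn0]
  · let f : U q →ₐ[ℂ] UHat n q ⊗[ℂ] UHat n q :=
      (Algebra.TensorProduct.map (mk n q) (mk n q)).comp (Bialgebra.comulAlgHom ℂ (U q))
    have hf : ∀ x, f x = Algebra.TensorProduct.map (mk n q) (mk n q) (Coalgebra.comul x) :=
      fun _ => rfl
    change f x = 0
    refine map_eq_zero_of_mem_ideal hn0 f ?_ ?_ ?_ hx
    · rw [hf, U.comul_KL, Algebra.TensorProduct.map_tmul, Algebra.TensorProduct.tmul_pow,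
        KL_pow hn0, Algebra.TensorProduct.one_def]
    · rw [hf, U.comul_gen, U.comulGen, map_add, Algebra.TensorProduct.map_tmul,
        Algebra.TensorProduct.map_tmul, map_one]
      refine add_pow_eq_zero_of_mul_eq_smul hp hn ?_ ?_ ?_
      · rw [Algebra.TensorProduct.tmul_pow, E_pow, TensorProduct.tmul_zero]
      · rw [Algebra.TensorProduct.tmul_pow, E_pow, TensorProduct.zero_tmul]
      · rw [Algebra.TensorProduct.tmul_mul_tmul, Algebra.TensorProduct.tmul_mul_tmul, E_KL hq,
          one_mul, mul_one, TensorProduct.tmul_smul]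
    · rw [hf, U.comul_gen, U.comulGen, map_add, Algebra.TensorProduct.map_tmul,
        Algebra.TensorProduct.map_tmul, map_one]
      refine add_pow_eq_zero_of_mul_eq_smul hp hn ?_ ?_ ?_
      · rw [Algebra.TensorProduct.tmul_pow, F_pow, TensorProduct.zero_tmul]
      · rw [Algebra.TensorProduct.tmul_pow, F_pow, TensorProduct.tmul_zero]
      · rw [Algebra.TensorProduct.tmul_mul_tmul, Algebra.TensorProduct.tmul_mul_tmul,
          F_KLbar hq, one_mul, mul_one, TensorProduct.smul_tmul']

/-! ### The antipode of the quotient -/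

/-- The antipode of `U q` followed by the projection, as an algebra morphism to the opposite
algebra of the quotient. -/
def antipodeOp (n : ℕ) (q : ℂ) : U q →ₐ[ℂ] (UHat n q)ᵐᵒᵖ :=
  (AlgHom.op (mk n q)).comp (U.lift (U.antipodeGen q) U.antipodeGen_rel)

lemma antipodeOp_gen (g : Gen) :
    antipodeOp n q (U.gen q g) = .op (mk n q (U.antipodeGen q g).unop) := by
  simp [antipodeOp]

lemma antipodeOp_eq_zero (hn : n ≠ 0) (x : U q) (hx : x ∈ ideal n q) :
    antipodeOp n q x = 0 := by
  refine map_eq_zero_of_mem_ideal hn (antipodeOp n q) ?_ ?_ ?_ hx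
  · rw [map_add, antipodeOp_gen, antipodeOp_gen, ← MulOpposite.op_add, ← MulOpposite.op_pow]
    simp only [U.antipodeGen, MulOpposite.unop_op]
    rw [← map_add, KLbar_pow hn, MulOpposite.op_one]
  · rw [antipodeOp_gen, ← MulOpposite.op_pow]
    simp only [U.antipodeGen, MulOpposite.unop_op]
    rw [map_neg, neg_pow, map_mul, mul_pow_eq_zero_of_mul_eq_smul KLbar_E E_pow, mul_zero,
      MulOpposite.op_zero]
  · rw [antipodeOp_gen, ← MulOpposite.op_pow]
    simp only [U.antipodeGen, MulOpposite.unop_op]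
    rw [map_neg, neg_pow, map_mul, KL_F, smul_pow, mul_pow_eq_zero_of_mul_eq_smul KL_F F_pow,
      smul_zero, mul_zero, MulOpposite.op_zero]

/-- The antimorphism induced on the quotient by the antipode of `U q`. -/
def antipode (hn : n ≠ 0) : UHat n q →ₗ[ℂ] UHat n q :=
  (MulOpposite.opLinearEquiv ℂ).symm.toLinearMap ∘ₗ
    (Ideal.Quotient.liftₐ (ideal n q) (antipodeOp n q) (antipodeOp_eq_zero hn)).toLinearMap

lemma antipode_mk (hn : n ≠ 0) (x : U q) :
    antipode hn (mk n q x) = mk n q (U.antipode q x) := rfl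

/-- The antipode of `U q` is von Neumann regular, and regularity passes to the quotient because
the projection is a surjective morphism of bialgebras. -/
lemma isVonNeumannAntipode (hn : n ≠ 0) (hq : q ≠ 0)
    [((ideal n q).restrictScalars ℂ).IsCoideal] :
    IsVonNeumannAntipode (antipode (n := n) (q := q) hn) :=
  (U.isVonNeumannAntipode hq).of_surjective (f := Bialgebra.Quotient.mkBialgHom (ideal n q))
    mk_surjective (fun _ => rfl)

end UHat

/-! ### The R-matrix of the quotient -/

namespace UHat

variable {n : ℕ} {q : ℂ}

section Bialgebra

variable [((ideal n q).restrictScalars ℂ).IsCoideal]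

lemma comul_mk (x : U q) : Coalgebra.comul (R := ℂ) (mk n q x) =
    Algebra.TensorProduct.map (mk n q) (mk n q) (Coalgebra.comul x) := rfl

lemma isSmallQuantumTriple (hn : n ≠ 0) (hq : q ≠ 0) :
    IsSmallQuantumTriple n q (mk n q (U.K + U.L)) (mk n q (U.Kbar + U.Lbar)) (mk n q U.E)
      (mk n q U.F) where
  k_k' := KL_mul_KLbar
  k'_k := KLbar_mul_KL
  k_pow := KL_pow hn
  E_pow := E_pow
  F_pow := F_pow
  E_k := E_KL hq
  k_F := KL_F
  E_F := E_F
  comul_k := by rw [comul_mk, U.comul_KL, Algebra.TensorProduct.map_tmul]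
  comul_E := by
    rw [comul_mk, U.comul_gen, U.comulGen, map_add, Algebra.TensorProduct.map_tmul,
      Algebra.TensorProduct.map_tmul, map_one]
  comul_F := by
    rw [comul_mk, U.comul_gen, U.comulGen, map_add, Algebra.TensorProduct.map_tmul,
      Algebra.TensorProduct.map_tmul, map_one]

/-- The comultiplication of a Cartan generator is symmetric, and each of its terms has weight
zero against `E ⊗ F`. -/
lemma comul_cartan_gen (hq : q ≠ 0) (g : Gen) (hE : g ≠ .E) (hF : g ≠ .F) :
    TensorProduct.comm ℂ _ _ (Coalgebra.comul (mk n q (U.gen q g))) =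
        Coalgebra.comul (mk n q (U.gen q g)) ∧
      Commute (Coalgebra.comul (mk n q (U.gen q g)))
        (mk n q (U.K + U.L) ⊗ₜ[ℂ] (1 : UHat n q)) ∧
      Commute (Coalgebra.comul (mk n q (U.gen q g)))
        ((1 : UHat n q) ⊗ₜ[ℂ] mk n q (U.K + U.L)) ∧
      Commute (Coalgebra.comul (mk n q (U.gen q g))) (mk n q U.E ⊗ₜ[ℂ] mk n q U.F) := by
  have hq2 : q ^ 2 ≠ 0 := pow_ne_zero 2 hq
  have h1 : ∀ a b : U q, Commute a (U.K + U.L) → Commute (mk n q a ⊗ₜ[ℂ] mk n q b)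
      (mk n q (U.K + U.L) ⊗ₜ[ℂ] (1 : UHat n q)) := by
    intro a b h
    rw [commute_iff_eq, Algebra.TensorProduct.tmul_mul_tmul, Algebra.TensorProduct.tmul_mul_tmul,
      one_mul, mul_one, ← map_mul, h.eq, map_mul]
  have h2 : ∀ a b : U q, Commute b (U.K + U.L) → Commute (mk n q a ⊗ₜ[ℂ] mk n q b)
      ((1 : UHat n q) ⊗ₜ[ℂ] mk n q (U.K + U.L)) := by
    intro a b h
    rw [commute_iff_eq, Algebra.TensorProduct.tmul_mul_tmul, Algebra.TensorProduct.tmul_mul_tmul,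
      one_mul, mul_one, ← map_mul, h.eq, map_mul]
  have h3 : ∀ (c : ℂ) (a b : U q), c ≠ 0 → a * U.E = c • (U.E * a) →
      b * U.F = c⁻¹ • (U.F * b) →
      Commute (mk n q a ⊗ₜ[ℂ] mk n q b) (mk n q U.E ⊗ₜ[ℂ] mk n q U.F) := by
    intro c a b hc ha hb
    rw [commute_iff_eq, Algebra.TensorProduct.tmul_mul_tmul, Algebra.TensorProduct.tmul_mul_tmul,
      ← map_mul, ← map_mul, ← map_mul, ← map_mul, ha, hb, map_smul, map_smul,
      TensorProduct.smul_tmul_smul, mul_inv_cancel₀ hc, one_smul]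
  have cK : Commute (U.K : U q) (U.K + U.L) := by
    simp [commute_iff_eq, mul_add, add_mul, U.K_L, U.L_K]
  have cL : Commute (U.L : U q) (U.K + U.L) := by
    simp [commute_iff_eq, mul_add, add_mul, U.K_L, U.L_K]
  have cK' : Commute (U.Kbar : U q) (U.K + U.L) := by
    simp [commute_iff_eq, mul_add, add_mul, U.K_comm, U.Kbar_L, U.L_Kbar]
  have cL' : Commute (U.Lbar : U q) (U.K + U.L) := by
    simp [commute_iff_eq, mul_add, add_mul, U.L_comm, U.Lbar_K, U.K_Lbar]
  have i2 : (q ^ 2)⁻¹ ≠ 0 := inv_ne_zero hq2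
  rw [comul_mk, U.comul_gen]
  cases g
  · simp only [U.comulGen, Algebra.TensorProduct.map_tmul]
    exact ⟨rfl, h1 _ _ cK, h2 _ _ cK, h3 _ _ _ hq2 U.K_E U.K_F⟩
  · simp only [U.comulGen, Algebra.TensorProduct.map_tmul]
    exact ⟨rfl, h1 _ _ cK', h2 _ _ cK', h3 _ _ _ i2 U.Kbar_E (by rw [inv_inv, U.Kbar_F])⟩
  · simp only [U.comulGen, map_add (Algebra.TensorProduct.map _ _),
      Algebra.TensorProduct.map_tmul]
    refine ⟨?_, ?_, ?_, ?_⟩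
    · simp only [map_add (TensorProduct.comm ℂ _ _), TensorProduct.comm_tmul]
      abel
    · exact ((h1 _ _ cL).add_left (h1 _ _ cL)).add_left (h1 _ _ cK)
    · exact ((h2 _ _ cL).add_left (h2 _ _ cK)).add_left (h2 _ _ cL)
    · exact ((h3 _ _ _ hq2 U.L_E U.L_F).add_left (h3 _ _ _ hq2 U.L_E U.K_F)).add_left
        (h3 _ _ _ hq2 U.K_E U.L_F)
  · have fK : (U.Kbar * U.F : U q) = ((q ^ 2)⁻¹)⁻¹ • (U.F * U.Kbar) := by rw [inv_inv, U.Kbar_F]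
    have fL : (U.Lbar * U.F : U q) = ((q ^ 2)⁻¹)⁻¹ • (U.F * U.Lbar) := by rw [inv_inv, U.Lbar_F]
    simp only [U.comulGen, map_add (Algebra.TensorProduct.map _ _),
      Algebra.TensorProduct.map_tmul]
    refine ⟨?_, ?_, ?_, ?_⟩
    · simp only [map_add (TensorProduct.comm ℂ _ _), TensorProduct.comm_tmul]
      abel
    · exact ((h1 _ _ cL').add_left (h1 _ _ cL')).add_left (h1 _ _ cK')
    · exact ((h2 _ _ cL').add_left (h2 _ _ cK')).add_left (h2 _ _ cL')
    · exact ((h3 _ _ _ i2 U.Lbar_E fL).add_left (h3 _ _ _ i2 U.Lbar_E fK)).add_left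
        (h3 _ _ _ i2 U.Kbar_E fL)
  · exact absurd rfl hE
  · exact absurd rfl hF

end Bialgebra

end UHat

lemma qInt_succ {q : ℂ} (hq : q ≠ 0) (hl : q - q⁻¹ ≠ 0) (m : ℕ) :
    qInt q (m + 1) = q ^ m * gaussInt (q ^ 2)⁻¹ (m + 1) := by
  have h1 := gaussInt_mul (q ^ 2)⁻¹ (m + 1)
  rw [qInt, div_eq_iff hl]
  have h2 : q - q⁻¹ = -q * ((q ^ 2)⁻¹ - 1) := by field_simp; ring
  rw [h2, mul_comm (-q), ← mul_assoc, mul_assoc (q ^ m), h1]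
  have h3 : q ^ (m + 1) ≠ 0 := pow_ne_zero _ hq
  have h4 : ((q ^ 2)⁻¹) ^ (m + 1) = (q ^ (m + 1))⁻¹ * (q ^ (m + 1))⁻¹ := by
    rw [inv_pow, ← pow_mul, mul_comm 2, mul_two, pow_add, mul_inv]
  rw [h4]
  have h5 : q ^ m * -q = - q ^ (m + 1) := by rw [pow_succ]; ring
  rw [mul_right_comm, h5]
  field_simp
  ring

lemma qFactorial_eq {q : ℂ} (hq : q ≠ 0) (hl : q - q⁻¹ ≠ 0) (m : ℕ) :
    qFactorial q m = q ^ m.choose 2 * gaussFactorial (q ^ 2)⁻¹ m := by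
  induction m with
  | zero => simp [qFactorial, gaussFactorial_zero]
  | succ m ih =>
    have h1 : qFactorial q (m + 1) = qFactorial q m * qInt q (m + 1) :=
      Finset.prod_Icc_succ_top (by omega) _
    rw [h1, ih, qInt_succ hq hl, gaussFactorial_succ, Nat.choose_succ_succ' m 1,
      Nat.choose_one_right, pow_add]
    ring

lemma coeffA_eq {q : ℂ} (hq : q ≠ 0) (hl : q - q⁻¹ ≠ 0) (n m i j : ℕ) :
    coeffA n q m i j = (n : ℂ)⁻¹ * (q ^ 2)⁻¹ ^ (i * j) * ((gaussFactorial (q ^ 2)⁻¹ m)⁻¹ *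
      (q - q⁻¹) ^ m) * ((q ^ 2) ^ (i * m) * (q ^ 2)⁻¹ ^ (j * m)) := by
  have h1 : q ^ ((m.choose 2 : ℤ) + 2 * m * ((i : ℤ) - j) - 2 * i * j) =
      q ^ m.choose 2 * ((q ^ 2)⁻¹ ^ (i * j) * ((q ^ 2) ^ (i * m) * (q ^ 2)⁻¹ ^ (j * m))) := by
    have h0 : ∀ a : ℕ, (q ^ 2)⁻¹ ^ a = q ^ (-(2 * a : ℤ)) := by
      intro a
      rw [inv_pow, ← pow_mul, zpow_neg]
      norm_cast
    rw [h0, h0, ← pow_mul, ← zpow_natCast q, ← zpow_natCast q, ← zpow_add₀ hq, ← zpow_add₀ hq,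
      ← zpow_add₀ hq]
    congr 1
    push_cast
    ring
  rw [coeffA, h1, qFactorial_eq hq hl, one_div, div_eq_mul_inv, mul_inv]
  have h2 : q ^ m.choose 2 ≠ 0 := pow_ne_zero _ hq
  generalize (gaussFactorial (q ^ 2)⁻¹ m)⁻¹ = g
  generalize (q ^ 2)⁻¹ ^ (i * j) = a
  generalize (q ^ 2) ^ (i * m) * (q ^ 2)⁻¹ ^ (j * m) = b
  field_simp

/-- Moving the powers of `k` to the left of the powers of `E` and `F` turns `∑ A_m^{ij}(q)
E ^ m k ^ i ⊗ F ^ m k ^ j` into the factorized form. -/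
lemma rMatrix_eq {n : ℕ} {q : ℂ} (hq : q ≠ 0) (hl : q - q⁻¹ ≠ 0) :
    rMatrix n q = factorizedRMatrix n q (UHat.mk n q (U.K + U.L)) (UHat.mk n q U.E)
      (UHat.mk n q U.F) := by
  have hE : UHat.mk n q (U.K + U.L) * UHat.mk n q U.E =
      (q ^ 2) • (UHat.mk n q U.E * UHat.mk n q (U.K + U.L)) := by
    rw [← map_mul, U.KL_E, map_smul, map_mul]
  have hF := UHat.KL_F (n := n) (q := q)
  rw [rMatrix, factorizedRMatrix, bichar, Finset.sum_mul]
  refine Finset.sum_congr rfl fun i _ => ?_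
  rw [eigenProj, mul_smul_comm, Finset.mul_sum, Finset.smul_sum, Finset.sum_mul]
  refine Finset.sum_congr rfl fun j _ => ?_
  rw [gaussExp, Finset.mul_sum]
  refine Finset.sum_congr rfl fun m _ => ?_
  change coeffA n q m i j • (UHat.mk n q (U.E ^ m * cartanPow q i) ⊗ₜ[ℂ]
    UHat.mk n q (U.F ^ m * cartanPow q j)) = _
  rw [U.cartanPow_eq_pow, U.cartanPow_eq_pow, map_mul, map_mul, map_pow, map_pow, map_pow,
    map_pow, coeffA_eq hq hl, gaussPow]
  simp only [smul_pow, Algebra.TensorProduct.tmul_pow, one_pow, mul_smul_comm, smul_mul_assoc,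
    Algebra.TensorProduct.tmul_mul_tmul, one_mul, mul_one,
    pow_mul_pow_of_mul_eq_smul hE, pow_mul_pow_of_mul_eq_smul hF, smul_smul,
    TensorProduct.smul_tmul_smul]
  congr 1
  ring

end VNHopf

end

theorem mainTheorem3 (n : ℕ) (q : ℂ) (hn : Odd n) (hn1 : 1 < n) (hq : IsPrimitiveRoot q n) :
    ∃ _biideal : ((VNHopf.ideal n q).restrictScalars ℂ).IsCoideal,
      (∃ T : VNHopf.UHat n q →ₗ[ℂ] VNHopf.UHat n q,
        (∀ x, T (Ideal.Quotient.mk _ x) = Ideal.Quotient.mk _ (VNHopf.U.antipode q x)) ∧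
        VNHopf.IsVonNeumannAntipode T) ∧
      VNHopf.IsUniversalRMatrix (VNHopf.rMatrix n q) := by
  have hn0 : n ≠ 0 := by omega
  have hq0 : q ≠ 0 := hq.ne_zero hn0
  -- As `n` is odd, `q ^ 2` is again a primitive `n`-th root of unity.
  have hq2 : IsPrimitiveRoot (q ^ 2) n :=
    hq.pow_of_coprime 2 (Nat.coprime_two_left.mpr hn)
  have hp : IsPrimitiveRoot (q ^ 2)⁻¹ n := hq2.inv
  have hl : q - q⁻¹ ≠ 0 := by
    intro h
    refine hq2.ne_one hn1 ?_
    rw [sq]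
    nth_rw 2 [sub_eq_zero.mp h]
    exact mul_inv_cancel₀ hq0
  have hI := VNHopf.UHat.isCoideal hn1 hq0 hp
  refine ⟨hI, ⟨VNHopf.UHat.antipode hn0, VNHopf.UHat.antipode_mk hn0,
    VNHopf.UHat.isVonNeumannAntipode hn0 hq0⟩, ?_⟩
  rw [VNHopf.rMatrix_eq hq0 hl]
  refine (VNHopf.UHat.isSmallQuantumTriple hn0 hq0).isUniversalRMatrix hn1 hp hl
    VNHopf.UHat.adjoin_range_gen ?_
  rintro _ ⟨g, rfl⟩
  by_cases hE : g = .E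
  · exact .inl (by rw [hE])
  by_cases hF : g = .F
  · exact .inr (.inl (by rw [hF]))
  · exact .inr (.inr (VNHopf.UHat.comul_cartan_gen hq0 g hE hF))
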